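/- \textbf{Theorem (periodizing operator for the Stokeslet, south sources).} Let $d,\eta>0$ and $\xi\in\mathbb R$ with $\sqrt{\xi^2+\eta^2}\le d$, put $\mathbf e_1=(d,0)$, $\mathbf e_2=(\xi,\eta)$, $\mathbf l_{mn}=m\mathbf e_1+n\mathbf e_2$, and let $\mathcal C=\{a\mathbf e_1+b\mathbf e_2 : a,b\in[-\tfrac12,\tfrac12]\}$ be the unit cell. For $\beta>0$ let $$G_\beta(\mathbf t)=-\frac1{2\pi\beta^2}\bigl[K_0(\beta|\mathbf t|)-\log(1/|\mathbf t|)\bigr],\qquad \mathbf G_\beta^{(\rm MS)}=\begin{pmatrix}-\partial_{yy}&\partial_{xy}\\ \partial_{xy}&-\partial_{xx}\end{pmatrix}G_\beta$$ be the modified Stokeslet, and let $$\mathbf K_\beta^{south}(\mathbf t,\mathbf s)=\sum_{n=-\infty}^{-2}\ \sum_{m=-\infty}^{\infty}\mathbf G_\beta^{(\rm MS)}\bigl(\mathbf t-(\mathbf s+\mathbf l_{mn})\bigr),\qquad \mathbf t,\mathbf s\in\mathcal C,$$ be the field of the images of $\mathbf s$ in the cells to the south. Both the inner and the outer series converge absolutely.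 A map $\mathbf K$ from pairs of points of $\mathbb R^2$ to real $2\times2$ matrices is called a \emph{south kernel for the Stokeslet with charge neutrality} if for all finitely many sources $\mathbf s_j\in\mathcal C$ with strengths $\mathbf q_j\in\mathbb R^2$, $\sum_j\mathbf q_j=0$, there are vectors $\mathbf c(\beta)\in\mathbb R^2$, independent of the target, such that $$\lim_{\beta\to0^+}\Bigl(\sum_j\mathbf K_\beta^{south}(\mathbf t,\mathbf s_j)\mathbf q_j-\mathbf c(\beta)\Bigr)=\sum_j\mathbf K(\mathbf t,\mathbf s_j)\mathbf q_j\qquad\text{for all }\mathbf t\in\mathcal C .$$ There is an absolute constant $C>0$ such that for all $d,\xi,\eta$ as above there is a south kernel $\mathbf K$ for the Stokeslet with charge neutrality for which the following hold. (i) Any other such kernel yields, for every charge-neutral collection of sources in $\mathcal C$, the same velocity field on $\mathcal C$ up to an additive constant vector. (ii) For all targets $\mathbf t_l=(x_l,y_l)\in\mathcal C$ ($l=1,\dots,N_T$), all sources $\mathbf s_j=(x'_j,y'_j)\in\mathcal C$ ($j=1,\dots,N_S$) and all precisions $0<\epsilon\le1$, the $N_T\times N_S$ block matrix $\mathbf P_2^{south}(l,j)=\mathbf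 K(\mathbf t_l,\mathbf s_j)$ satisfies $$\mathbf P_2^{south}=\mathbf L\,\mathbf D_a\,\mathbf R-\mathbf D_T\,\mathbf L\,\mathbf D_b\,\mathbf R+\mathbf L\,\mathbf D_b\,\mathbf R\,\mathbf D_S+\mathbf E,$$ where every entry of $\mathbf E$ has modulus at most $C\epsilon$. Here $$M=\Bigl\lceil\frac d{2\pi\eta}\log\Bigl(\frac1{1-e^{-2\pi\eta/d}}\,\frac1\epsilon\Bigr)\Bigr\rceil,\qquad \alpha_m=\frac{2\pi m}d,\qquad Q_m=|\alpha_m|\eta-i\alpha_m\xi\qquad(-M\le m\le M),$$ all matrices are block matrices with $2\times2$ blocks, $\mathbf I_2$ is the $2\times2$ identity matrix, $\mathbf L$ is $N_T\times(2M+1)$ and $\mathbf R$ is $(2M+1)\times N_S$ with $$\mathbf L(l,m)=e^{-|\alpha_m|y_l}e^{i\alpha_mx_l}\,\mathbf I_2,\quad \mathbf R(m,j)=e^{|\alpha_m|y'_j}e^{-i\alpha_mx'_j}\,\mathbf I_2\quad(m\ne0),\qquad \mathbf L(l,0)=y_l\,\mathbf I_2,\quad \mathbf R(0,j)=y'_j\,\mathbf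 I_2,$$ and the remaining matrices are block diagonal with $\mathbf D_T(l,l)=y_l\,\mathbf I_2$, $\mathbf D_S(j,j)=y'_j\,\mathbf I_2$, $$\mathbf D_a(m,m)=\frac1{4d}\,\frac{e^{-2Q_m}}{1-e^{-Q_m}}\left(\frac1{|\alpha_m|}\mathbf I_2-\frac{2-e^{-Q_m}}{1-e^{-Q_m}}\,\eta\begin{pmatrix}1&i\,\mathrm{sign}(m)\\ i\,\mathrm{sign}(m)&-1\end{pmatrix}\right)\quad(m\ne0),$$ $$\mathbf D_b(m,m)=\frac1{4d}\,\frac{e^{-2Q_m}}{1-e^{-Q_m}}\begin{pmatrix}1&i\,\mathrm{sign}(m)\\ i\,\mathrm{sign}(m)&-1\end{pmatrix}\quad(m\ne0),$$ $$\mathbf D_a(0,0)=-\frac1{2d\eta}\begin{pmatrix}1&0\\0&0\end{pmatrix},\qquad \mathbf D_b(0,0)=0 .$$ -/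

import Mathlib

open Filter Topology MeasureTheory

namespace PeriodicStokes

noncomputable section

/-- A `2 × 2` block with complex entries. -/
abbrev Block : Type := Matrix (Fin 2) (Fin 2) ℂ

/-- The modified Bessel function of the second kind of order zero, for `z > 0`, in its standard
integral representation `K₀(z) = (1/2) ∫_0^∞ exp(-s - z² / (4 s)) ds / s`
(which is `∫_0^∞ exp(-z cosh u) du` after the substitution `s = (z/2) exp u`). -/
def besselK0 (z : ℝ) : ℝ :=
  (1 / 2) * ∫ s in Set.Ioi (0 : ℝ), Real.exp (-s - z ^ 2 / (4 * s)) / s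

/-- The fundamental solution of the modified biharmonic equation,
`-(1 / (2 π β²)) (K₀(β |t|) - log (1 / |t|))` at `t = (x, y)`. -/
def greenMB (β x y : ℝ) : ℝ :=
  -(1 / (2 * Real.pi * β ^ 2)) *
    (besselK0 (β * Real.sqrt (x ^ 2 + y ^ 2)) - Real.log (1 / Real.sqrt (x ^ 2 + y ^ 2)))

/-- The modified Stokeslet `(∇ ⊗ ∇ - Δ I) G_MB`, with entries `-∂_yy`, `∂_xy`, `∂_xy`, `-∂_xx`
of `G_MB`. -/
def modifiedStokeslet (β : ℝ) (t : ℝ × ℝ) : Matrix (Fin 2) (Fin 2) ℝ :=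
  !![-(deriv (fun y => deriv (fun y' => greenMB β t.1 y') y) t.2),
      deriv (fun x => deriv (fun y => greenMB β x y) t.2) t.1;
      deriv (fun x => deriv (fun y => greenMB β x y) t.2) t.1,
      -(deriv (fun x => deriv (fun x' => greenMB β x' t.2) x) t.1)]

/-- The lattice vector `m e₁ + n e₂`, where `e₁ = (d, 0)` and `e₂ = (ξ, η)`. -/
def latticeVec (d ξ η : ℝ) (m n : ℤ) : ℝ × ℝ :=
  ((m : ℝ) * d + (n : ℝ) * ξ, (n : ℝ) * η)

/-- The closed unit cell spanned by `(d, 0)` and `(ξ, η)`, centered at the origin. -/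
def unitCell (d ξ η : ℝ) : Set (ℝ × ℝ) :=
  {t | ∃ a ∈ Set.Icc (-(1 / 2) : ℝ) (1 / 2), ∃ b ∈ Set.Icc (-(1 / 2) : ℝ) (1 / 2),
    t = (a * d + b * ξ, b * η)}

/-- The velocity at `t` due to the row `n = -(k + 2)` of images of the source `s`. -/
def modifiedSouthRow (d ξ η β : ℝ) (t s : ℝ × ℝ) (k : ℕ) : Matrix (Fin 2) (Fin 2) ℝ :=
  ∑' m : ℤ, modifiedStokeslet β (t - (s + latticeVec d ξ η m (-((k : ℤ) + 2))))

/-- The south kernel of the modified Stokes equations: the sum over all images with `n ≤ -2`,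
row by row. -/
def modifiedSouthKernel (d ξ η β : ℝ) (t s : ℝ × ℝ) : Matrix (Fin 2) (Fin 2) ℝ :=
  ∑' k : ℕ, modifiedSouthRow d ξ η β t s k

/-- The velocity field at `t` that a kernel `K` assigns to sources `s j` of strengths `q j`. -/
def velocity {N : ℕ} (K : ℝ × ℝ → ℝ × ℝ → Matrix (Fin 2) (Fin 2) ℝ)
    (s : Fin N → ℝ × ℝ) (q : Fin N → Fin 2 → ℝ) (t : ℝ × ℝ) : Fin 2 → ℝ :=
  ∑ j, (K t (s j)).mulVec (q j)

/-- `K` is a south kernel for the Stokeslet with charge neutrality: for all sources in the unit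
cell whose vector strengths add up to zero, the velocity field given by `K` is the limit as
`β → 0⁺` of the field of the south images for the modified Stokes equations, up to
an additive constant (a vector that does not depend on the target; it may depend on `β`). -/
def IsStokesSouthKernel (d ξ η : ℝ)
    (K : ℝ × ℝ → ℝ × ℝ → Matrix (Fin 2) (Fin 2) ℝ) : Prop :=
  ∀ (N : ℕ) (s : Fin N → ℝ × ℝ) (q : Fin N → Fin 2 → ℝ),
    (∀ j, s j ∈ unitCell d ξ η) → ∑ j, q j = 0 →
    ∃ c : ℝ → Fin 2 → ℝ, ∀ t ∈ unitCell d ξ η,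
      Tendsto (fun β : ℝ => velocity (modifiedSouthKernel d ξ η β) s q t - c β)
        (𝓝[>] 0) (𝓝 (velocity K s q t))

/-- The truncation parameter
`M = ⌈ d / (2 π η) log (1 / (1 - exp (-2 π η / d)) * 1 / ε) ⌉`. -/
def truncation (d η ε : ℝ) : ℕ :=
  ⌈d / (2 * Real.pi * η) *
    Real.log (1 / (1 - Real.exp (-(2 * Real.pi * η / d))) * (1 / ε))⌉₊

/-- The modes `m = -M, …, M`. -/
abbrev Mode (M : ℕ) : Type := ↥(Finset.Icc (-(M : ℤ)) (M : ℤ))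

/-- `α_m = 2 π m / d`. -/
def alpha (d : ℝ) (m : ℤ) : ℝ := 2 * Real.pi * (m : ℝ) / d

/-- `Q_m = |α_m| η - i α_m ξ`. -/
def Qm (d ξ η : ℝ) (m : ℤ) : ℂ :=
  ((|alpha d m| * η : ℝ) : ℂ) - Complex.I * ((alpha d m * ξ : ℝ) : ℂ)

/-- The `2 × 2` matrix with rows `(1, i sign m)` and `(i sign m, -1)`. -/
def signBlock (m : ℤ) : Block :=
  !![1, Complex.I * (m.sign : ℂ); Complex.I * (m.sign : ℂ), -1]

/-- The `N_T × (2M+1)` block matrix `L`. -/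
def southL (d : ℝ) {NT : ℕ} (M : ℕ) (t : Fin NT → ℝ × ℝ) :
    Matrix (Fin NT) (Mode M) Block :=
  Matrix.of fun l m =>
    if (m : ℤ) = 0 then ((t l).2 : ℂ) • (1 : Block)
    else (Complex.exp (-((|alpha d m| * (t l).2 : ℝ) : ℂ)) *
      Complex.exp (Complex.I * ((alpha d m * (t l).1 : ℝ) : ℂ))) • (1 : Block)

/-- The `(2M+1) × N_S` block matrix `R`. -/
def southR (d : ℝ) {NS : ℕ} (M : ℕ) (s : Fin NS → ℝ × ℝ) :
    Matrix (Mode M) (Fin NS) Block :=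
  Matrix.of fun m j =>
    if (m : ℤ) = 0 then ((s j).2 : ℂ) • (1 : Block)
    else (Complex.exp ((|alpha d m| * (s j).2 : ℝ) : ℂ) *
      Complex.exp (-(Complex.I * ((alpha d m * (s j).1 : ℝ) : ℂ)))) • (1 : Block)

/-- The block diagonal matrix `D_a`. -/
def southDa (d ξ η : ℝ) (M : ℕ) : Matrix (Mode M) (Mode M) Block :=
  Matrix.diagonal fun m =>
    if (m : ℤ) = 0 then (-(1 / (2 * (d : ℂ) * (η : ℂ)))) • !![1, 0; 0, 0]
    else (1 / (4 * (d : ℂ)) *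
        (Complex.exp (-2 * Qm d ξ η m) / (1 - Complex.exp (-Qm d ξ η m)))) •
      ((1 / ((|alpha d m| : ℝ) : ℂ)) • (1 : Block) -
        ((2 - Complex.exp (-Qm d ξ η m)) / (1 - Complex.exp (-Qm d ξ η m)) * (η : ℂ)) •
          signBlock m)

/-- The block diagonal matrix `D_b`. -/
def southDb (d ξ η : ℝ) (M : ℕ) : Matrix (Mode M) (Mode M) Block :=
  Matrix.diagonal fun m =>
    if (m : ℤ) = 0 then 0
    else (1 / (4 * (d : ℂ)) *
        (Complex.exp (-2 * Qm d ξ η m) / (1 - Complex.exp (-Qm d ξ η m)))) • signBlock m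

/-- The block diagonal matrix with blocks `y_i I₂`, for points `p i = (x_i, y_i)`. It is `D_T` for
the targets and `D_S` for the sources. -/
def diagY {N : ℕ} (p : Fin N → ℝ × ℝ) : Matrix (Fin N) (Fin N) Block :=
  Matrix.diagonal fun i => ((p i).2 : ℂ) • (1 : Block)

/-- The low-rank operator `L D_a R - D_T L D_b R + L D_b R D_S`, truncated for precision `ε`. -/
def southLowRank (d ξ η ε : ℝ) {NT NS : ℕ} (t : Fin NT → ℝ × ℝ) (s : Fin NS → ℝ × ℝ) :
    Matrix (Fin NT) (Fin NS) Block :=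
  let M := truncation d η ε
  southL d M t * southDa d ξ η M * southR d M s
    - diagY t * southL d M t * southDb d ξ η M * southR d M s
    + southL d M t * southDb d ξ η M * southR d M s * diagY s

/-- The `N_T × N_S` block matrix with `(l, j)` block `K (t_l, s_j)`. -/
def blockOperator {NT NS : ℕ} (K : ℝ × ℝ → ℝ × ℝ → Matrix (Fin 2) (Fin 2) ℝ)
    (t : Fin NT → ℝ × ℝ) (s : Fin NS → ℝ × ℝ) : Matrix (Fin NT) (Fin NS) Block :=
  Matrix.of fun l j => (K (t l) (s j)).map Complex.ofReal

end

end PeriodicStokes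

open PeriodicStokes

/-! Everything is expressed through the integrals `expInt ν p c` = ∫₀^∞ s^(-ν) exp(-ps - c/s) ds.
K₀(β r) is half of the one with ν = 1, p = β², c = r²/4. Differentiating in c raises ν by one, and
the derivatives of log r are the same integrals with p = 0. The entries of the modified Stokeslet
are therefore explicit combinations of integrals of orders 1, 2, 3. For fixed s the integrand is a
Gaussian in the horizontal variable, so its Fourier transform lowers ν by 1/2 and adds α² to p.
Half-integer orders are elementary, and Poisson summation turns each row of images into a Fourier
series with the exponential coefficients `rowMode` (`sameSum_stokeslet`).

For m ≠ 0 the coefficients are difference quotients, with step β² in τ = χ², of functions such as √τ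
exp(-√τ z). The mean value theorem bounds them uniformly in β, their limits are derivatives at τ =
α², and the bound is summable jointly in the row and the mode (`norm_southTerm_le`), so dominated
convergence applies. Only the mode m = 0 is singular. Its sum over the rows is a geometric series of
size β⁻², with target and source entering through exp(-β y) exp(β y'). Writing this product as
(exp(-β y) - 1) + exp(β y') + (exp(-β y) - 1)(exp(β y') - 1) isolates a part removed by charge
neutrality, a part independent of the target that goes into c(β), and a part converging to -y
y'/(2dη) (`zeroMode_eq`, `tendsto_zeroCoupling`). Uniqueness up to constants is uniqueness of
limits.

In the limit, moving down one row multiplies mode m by ω = exp(-Q_m), up to a term linear in the row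
number. Summing the rows first gives closed forms (`hasSum_southTermLimit`), which separate into
functions of target and source and are exactly the terms of the factorization. The error is then the
tail |m| > M, dominated by a geometric series with ratio r = exp(-2πη/d), and M is chosen so that
r^M ≤ (1 - r)ε. -/

open scoped FourierTransform

namespace PeriodicStokes

noncomputable section

/-! ### Bessel-type integrals: convergence, derivatives, recurrence -/

/-- The integrand of `expInt`. -/
def expKer (ν p c s : ℝ) : ℝ := s ^ (-ν) * Real.exp (-(p * s) - c / s)

/-- `∫_0^∞ s^(-ν) exp (-p s - c / s) ds`, which is `2 (p / c)^((ν-1)/2) K_{ν-1} (2 √(p c))`. -/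
def expInt (ν p c : ℝ) : ℝ := ∫ s in Set.Ioi (0 : ℝ), expKer ν p c s

lemma expKer_nonneg (ν p c : ℝ) {s : ℝ} (hs : 0 < s) : 0 ≤ expKer ν p c s := by
  unfold expKer; positivity

lemma continuousOn_expKer (ν p c : ℝ) : ContinuousOn (expKer ν p c) (Set.Ioi 0) := by
  unfold expKer
  refine ContinuousOn.mul ?_ ?_
  · exact fun s hs => (Real.continuousAt_rpow_const s _ (Or.inl (ne_of_gt hs))).continuousWithinAt
  · refine Real.continuous_exp.comp_continuousOn ?_
    refine ContinuousOn.sub (by fun_prop) ?_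
    exact continuousOn_const.div continuousOn_id fun s hs => ne_of_gt hs

lemma aestronglyMeasurable_expKer (ν p c : ℝ) :
    AEStronglyMeasurable (expKer ν p c) (volume.restrict (Set.Ioi 0)) :=
  (continuousOn_expKer ν p c).aestronglyMeasurable measurableSet_Ioi

/-- The substitution u = 1/s turns the case p = 0 into a Gamma integrand. The right side has the
shape of the change of variables formula for s ↦ s^(-1). -/
lemma expKer_eq_inv_comp (ν c : ℝ) {s : ℝ} (hs : 0 < s) :
    expKer ν 0 c s =
      (|(-1 : ℝ)| * s ^ ((-1 : ℝ) - 1)) • ((s ^ (-1 : ℝ)) ^ ((ν - 1) - 1) *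
        Real.exp (-(c * s ^ (-1 : ℝ)))) := by
  unfold expKer
  rw [← Real.rpow_mul hs.le, smul_eq_mul, abs_neg, abs_one, one_mul, ← mul_assoc,
    ← Real.rpow_add hs, Real.rpow_neg_one]
  congr 1
  · congr 1; ring
  · congr 1; rw [div_eq_mul_inv]; ring

lemma integrableOn_expKer_zero {ν c : ℝ} (hν : 1 < ν) (hc : 0 < c) :
    IntegrableOn (expKer ν 0 c) (Set.Ioi 0) := by
  have h := (integrableOn_Ioi_comp_rpow_iff
    (fun u : ℝ => u ^ ((ν - 1) - 1) * Real.exp (-(c * u))) (p := -1) (by norm_num)).mpr ?_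
  · exact h.congr_fun (fun s hs => (expKer_eq_inv_comp ν c hs).symm) measurableSet_Ioi
  · have := integrableOn_rpow_mul_exp_neg_mul_rpow (s := ν - 1 - 1) (p := 1) (b := c)
      (by linarith) one_pos hc
    simpa using this

lemma expInt_zero {ν c : ℝ} (hν : 1 < ν) (hc : 0 < c) :
    expInt ν 0 c = (1 / c) ^ (ν - 1) * Real.Gamma (ν - 1) := by
  rw [← Real.integral_rpow_mul_exp_neg_mul_Ioi (sub_pos.mpr hν) hc,
    ← integral_comp_rpow_Ioi _ (show (-1 : ℝ) ≠ 0 by norm_num)]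
  exact setIntegral_congr_fun measurableSet_Ioi fun s hs => expKer_eq_inv_comp ν c hs

lemma expKer_le {ν p c s : ℝ} (hp : 0 ≤ p) (hs : 0 < s) : expKer ν p c s ≤ expKer ν 0 c s := by
  unfold expKer
  gcongr

/-- From exp(-ps) ≤ 1/(ps): positivity of p is traded for one more power of 1/s. This reaches orders
0 < ν ≤ 1, in particular K₀, for which the integral with p = 0 diverges at infinity. -/
lemma expKer_le_succ {ν p c s : ℝ} (hp : 0 < p) (hs : 0 < s) :
    expKer ν p c s ≤ p⁻¹ * expKer (ν + 1) 0 c s := by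
  unfold expKer
  have h1 : Real.exp (-(p * s)) ≤ (p * s)⁻¹ := by
    rw [Real.exp_neg]
    exact inv_anti₀ (by positivity) (by linarith [Real.add_one_le_exp (p * s)])
  have h2 : s ^ (-(ν + 1)) = s ^ (-ν) * s⁻¹ := by
    rw [neg_add, Real.rpow_add hs, Real.rpow_neg_one]
  rw [h2, sub_eq_add_neg, Real.exp_add]
  calc s ^ (-ν) * (Real.exp (-(p * s)) * Real.exp (-(c / s)))
      ≤ s ^ (-ν) * ((p * s)⁻¹ * Real.exp (-(c / s))) := by gcongr
    _ = _ := by rw [mul_inv]; simp; ring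

lemma integrableOn_expKer {ν p c : ℝ} (h : (0 < p ∧ 0 < ν) ∨ (0 ≤ p ∧ 1 < ν)) (hc : 0 < c) :
    IntegrableOn (expKer ν p c) (Set.Ioi 0) := by
  rcases h with ⟨hp, hν⟩ | ⟨hp, hν⟩
  · refine Integrable.mono' ((integrableOn_expKer_zero (ν := ν + 1) (by linarith) hc).const_mul p⁻¹)
      (aestronglyMeasurable_expKer _ _ _) ?_
    filter_upwards [ae_restrict_mem measurableSet_Ioi] with s hs
    rw [Real.norm_of_nonneg (expKer_nonneg _ _ _ hs)]
    exact expKer_le_succ hp hs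
  · refine Integrable.mono' (integrableOn_expKer_zero hν hc)
      (aestronglyMeasurable_expKer _ _ _) ?_
    filter_upwards [ae_restrict_mem measurableSet_Ioi] with s hs
    rw [Real.norm_of_nonneg (expKer_nonneg _ _ _ hs)]
    exact expKer_le hp hs

lemma expInt_nonneg (ν p c : ℝ) : 0 ≤ expInt ν p c :=
  setIntegral_nonneg measurableSet_Ioi fun _ hs => expKer_nonneg _ _ _ hs

lemma expInt_le {ν p c : ℝ} (hν : 1 < ν) (hp : 0 ≤ p) (hc : 0 < c) :
    expInt ν p c ≤ (1 / c) ^ (ν - 1) * Real.Gamma (ν - 1) := by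
  rw [← expInt_zero hν hc]
  exact setIntegral_mono_on (integrableOn_expKer (Or.inr ⟨hp, hν⟩) hc)
    (integrableOn_expKer_zero hν hc) measurableSet_Ioi fun s hs => expKer_le hp hs

lemma expInt_le_succ {ν p c : ℝ} (hν : 0 < ν) (hp : 0 < p) (hc : 0 < c) :
    expInt ν p c ≤ p⁻¹ * ((1 / c) ^ ν * Real.Gamma ν) := by
  have h := expInt_zero (ν := ν + 1) (by linarith) hc
  rw [add_sub_cancel_right] at h
  rw [← h, expInt, expInt, ← integral_const_mul]
  exact setIntegral_mono_on (integrableOn_expKer (Or.inl ⟨hp, hν⟩) hc)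
    ((integrableOn_expKer_zero (by linarith) hc).const_mul _) measurableSet_Ioi
    fun s hs => expKer_le_succ hp hs

/-- Differentiation under the integral sign brings down -1/s. For parameters above c/2 the
derivative is dominated by its kernel at c/2. -/
lemma hasDerivAt_expInt {ν p c : ℝ} (h : (0 < p ∧ 0 < ν) ∨ (0 ≤ p ∧ 1 < ν)) (hc : 0 < c) :
    HasDerivAt (expInt ν p) (-expInt (ν + 1) p c) c := by
  have h' : (0 < p ∧ 0 < ν + 1) ∨ (0 ≤ p ∧ 1 < ν + 1) := by
    rcases h with ⟨hp, hν⟩ | ⟨hp, hν⟩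
    · exact Or.inl ⟨hp, by linarith⟩
    · exact Or.inr ⟨hp, by linarith⟩
  have key := (hasDerivAt_integral_of_dominated_loc_of_deriv_le
    (μ := volume.restrict (Set.Ioi (0 : ℝ))) (F := fun c s => expKer ν p c s)
    (F' := fun c s => -expKer (ν + 1) p c s) (x₀ := c) (s := Set.Ioi (c / 2))
    (bound := expKer (ν + 1) p (c / 2)) (Ioi_mem_nhds (by linarith))
    (Eventually.of_forall fun c' => aestronglyMeasurable_expKer _ _ _)
    (integrableOn_expKer h hc) (aestronglyMeasurable_expKer _ _ _).neg ?_
    (integrableOn_expKer h' (by linarith)) ?_).2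
  · rwa [integral_neg] at key
  · filter_upwards [ae_restrict_mem measurableSet_Ioi] with s hs x hx
    have hs : 0 < s := hs
    have hx : c / 2 < x := hx
    rw [norm_neg, Real.norm_of_nonneg (expKer_nonneg _ _ _ hs)]
    unfold expKer
    gcongr
  · filter_upwards [ae_restrict_mem measurableSet_Ioi] with s hs x hx
    have hs : 0 < s := hs
    unfold expKer
    have h2 : s ^ (-(ν + 1)) = s ^ (-ν) * s⁻¹ := by
      rw [neg_add, Real.rpow_add hs, Real.rpow_neg_one]
    have := ((((hasDerivAt_id x).div_const s).const_sub (-(p * s))).exp).const_mul (s ^ (-ν))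
    refine this.congr_deriv ?_
    rw [h2]; simp; ring

lemma continuousOn_expInt {ν p : ℝ} (h : (0 < p ∧ 0 < ν) ∨ (0 ≤ p ∧ 1 < ν)) :
    ContinuousOn (expInt ν p) (Set.Ioi 0) := fun _ hc =>
  (hasDerivAt_expInt h hc).continuousAt.continuousWithinAt

/-- The recurrence of the Bessel functions `K₀`, `K₁`, `K₂`, by integration by parts. -/
lemma expInt_recurrence {p c : ℝ} (hp : 0 < p) (hc : 0 < c) :
    c * expInt 3 p c = expInt 2 p c + p * expInt 1 p c := by
  have i1 := integrableOn_expKer (ν := 1) (Or.inl ⟨hp, by norm_num⟩) hc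
  have i2 := integrableOn_expKer (ν := 2) (Or.inl ⟨hp, by norm_num⟩) hc
  have i3 := integrableOn_expKer (ν := 3) (Or.inl ⟨hp, by norm_num⟩) hc
  have bd : ∀ s : ℝ, 0 < s → expKer 1 p c s ≤ s⁻¹ := by
    intro s hs
    unfold expKer
    rw [Real.rpow_neg_one]
    refine mul_le_of_le_one_right (by positivity) (Real.exp_le_one_iff.mpr ?_)
    have : 0 ≤ c / s := by positivity
    nlinarith [mul_pos hp hs]
  have bd0 : ∀ s : ℝ, 0 ≤ s → expKer 1 p c s ≤ 2 / c ^ 2 * s := by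
    intro s hs
    rcases hs.eq_or_lt with rfl | hs
    · simp [expKer]
    have e1 : expKer 1 p c s ≤ expKer 1 0 c s := expKer_le hp.le hs
    refine e1.trans ?_
    unfold expKer
    rw [Real.rpow_neg_one]
    have h1 : Real.exp (-(c / s)) ≤ 2 / (c / s) ^ 2 := by
      rw [Real.exp_neg, inv_le_comm₀ (Real.exp_pos _) (by positivity), inv_div]
      have := Real.quadratic_le_exp_of_nonneg (x := c / s) (by positivity)
      have h0 : 0 ≤ c / s := by positivity
      linarith
    calc s⁻¹ * Real.exp (-(0 * s) - c / s) = s⁻¹ * Real.exp (-(c / s)) := by simp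
      _ ≤ s⁻¹ * (2 / (c / s) ^ 2) := by gcongr
      _ = _ := by field_simp
  have nn : ∀ s : ℝ, 0 ≤ s → 0 ≤ expKer 1 p c s := by
    intro s hs; unfold expKer; positivity
  -- The boundary function s⁻¹ exp(-ps - c/s) vanishes at both ends. At s = 0 this uses the
  -- convention `0 ^ (-1) = 0`, consistent with the limit by the bound `bd0`.
  have key := integral_Ioi_of_hasDerivAt_of_tendsto (a := 0) (m := 0)
    (f := expKer 1 p c)
    (f' := fun s => (c * expKer 3 p c s - expKer 2 p c s) - p * expKer 1 p c s) ?_ ?_ ?_ ?_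
  · have i4 : IntegrableOn (fun s => c * expKer 3 p c s - expKer 2 p c s) (Set.Ioi 0) :=
      (i3.const_mul c).sub i2
    rw [integral_sub i4 (i1.const_mul p), integral_sub (i3.const_mul c) i2,
      integral_const_mul, integral_const_mul] at key
    have e0 : expKer 1 p c 0 = 0 := by simp [expKer]
    rw [e0, sub_zero] at key
    unfold expInt
    linarith
  · have e0 : expKer 1 p c 0 = 0 := by simp [expKer]
    unfold ContinuousWithinAt
    rw [e0]
    have hl : Tendsto (fun s : ℝ => 2 / c ^ 2 * s) (𝓝[≥] 0) (𝓝 0) := by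
      have : Tendsto (fun s : ℝ => 2 / c ^ 2 * s) (𝓝 0) (𝓝 (2 / c ^ 2 * 0)) :=
        (continuous_const.mul continuous_id).tendsto 0
      rw [mul_zero] at this
      exact this.mono_left nhdsWithin_le_nhds
    refine tendsto_of_tendsto_of_tendsto_of_le_of_le' tendsto_const_nhds hl ?_ ?_
    · filter_upwards [self_mem_nhdsWithin] with s hs using nn s hs
    · filter_upwards [self_mem_nhdsWithin] with s hs using bd0 s hs
  · intro s hs
    have hs : 0 < s := hs
    have h0 := ((((hasDerivAt_id s).const_mul p).neg.sub
      ((hasDerivAt_const s c).div (hasDerivAt_id s) hs.ne')).exp)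
    have h1 := (Real.hasDerivAt_rpow_const (x := s) (p := -1) (Or.inl hs.ne')).mul h0
    refine h1.congr_deriv ?_
    unfold expKer
    have r1 : s ^ (-1 : ℝ) = s⁻¹ := Real.rpow_neg_one s
    have r2 : s ^ (-2 : ℝ) = (s ^ 2)⁻¹ := by
      rw [Real.rpow_neg hs.le]; norm_cast
    have r3 : s ^ (-3 : ℝ) = (s ^ 3)⁻¹ := by
      rw [Real.rpow_neg hs.le]; norm_cast
    have r4 : s ^ (-1 - 1 : ℝ) = (s ^ 2)⁻¹ := by rw [← r2]; norm_num
    simp only [r1, r2, r3, r4, id, Pi.div_apply, Pi.sub_apply, Pi.neg_apply]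
    field_simp
    simp
    ring
  · exact ((i3.const_mul c).sub i2).sub (i1.const_mul p)
  · refine tendsto_of_tendsto_of_tendsto_of_le_of_le' tendsto_const_nhds tendsto_inv_atTop_zero ?_ ?_
    · filter_upwards [eventually_gt_atTop 0] with s hs using nn s hs.le
    · filter_upwards [eventually_gt_atTop 0] with s hs using bd s hs

/-! ### Elementary closed forms at half-integer order -/

/-- The inversion s ↦ 1/s exchanges p and c and sends ν to 2 - ν. -/
lemma expInt_half_eq_swap (p c : ℝ) : expInt (1 / 2) p c = expInt (3 / 2) c p := by
  unfold expInt
  rw [← integral_comp_rpow_Ioi (expKer (1 / 2) p c) (show (-1 : ℝ) ≠ 0 by norm_num)]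
  refine setIntegral_congr_fun measurableSet_Ioi fun s hs => ?_
  have hs : 0 < s := hs
  unfold expKer
  rw [← Real.rpow_mul hs.le, smul_eq_mul, abs_neg, abs_one, one_mul, ← mul_assoc,
    ← Real.rpow_add hs, Real.rpow_neg_one]
  congr 1
  · congr 1; norm_num
  · congr 1; rw [div_inv_eq_mul, div_eq_mul_inv]; ring

/-- Rescaling s by p/c also exchanges p and c, but keeps ν. Combined with the inversion it expresses
order 3/2 through order 1/2. -/
lemma expInt_swap {p c : ℝ} (hp : 0 < p) (hc : 0 < c) :
    Real.sqrt p * expInt (3 / 2) c p = Real.sqrt c * expInt (3 / 2) p c := by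
  have hb : 0 < p / c := by positivity
  have h := integral_comp_mul_left_Ioi (expKer (3 / 2) c p) 0 hb
  rw [mul_zero, smul_eq_mul] at h
  have e : ∫ s in Set.Ioi (0 : ℝ), expKer (3 / 2) c p (p / c * s) =
      (p / c) ^ (-(3 / 2) : ℝ) * expInt (3 / 2) p c := by
    unfold expInt
    rw [← integral_const_mul]
    refine setIntegral_congr_fun measurableSet_Ioi fun s hs => ?_
    have hs : 0 < s := hs
    unfold expKer
    rw [Real.mul_rpow hb.le hs.le, mul_assoc]
    congr 3
    field_simp
  rw [e] at h
  have e2 : (p / c) ^ (-(3 / 2) : ℝ) = (p / c)⁻¹ * (Real.sqrt c / Real.sqrt p) := by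
    rw [show (-(3 / 2) : ℝ) = -1 + -(1 / 2) by norm_num, Real.rpow_add hb, Real.rpow_neg_one,
      Real.rpow_neg hb.le, ← Real.sqrt_eq_rpow, Real.sqrt_div hp.le, inv_div, inv_div]
  rw [e2, mul_assoc] at h
  have h2 := mul_left_cancel₀ (inv_ne_zero hb.ne') h
  have hsp : 0 < Real.sqrt p := Real.sqrt_pos.mpr hp
  unfold expInt at h2 ⊢
  rw [← h2]
  field_simp

/-- Supplies the initial value, a Gamma integral at 1/2, for the differential equation in c that
determines order 1/2. -/
lemma tendsto_expInt_half {p : ℝ} (hp : 0 < p) :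
    Tendsto (fun c => expInt (1 / 2) p c) (𝓝[>] 0)
      (𝓝 (Real.sqrt (Real.pi / p))) := by
  have hi : IntegrableOn (fun s : ℝ => s ^ (-(1 / 2) : ℝ) * Real.exp (-(p * s))) (Set.Ioi 0) := by
    have := integrableOn_rpow_mul_exp_neg_mul_rpow (s := -(1 / 2)) (p := 1) (b := p)
      (by norm_num) one_pos hp
    simpa using this
  have hv : ∫ s in Set.Ioi (0 : ℝ), s ^ (-(1 / 2) : ℝ) * Real.exp (-(p * s)) =
      Real.sqrt (Real.pi / p) := by
    have := Real.integral_rpow_mul_exp_neg_mul_Ioi (a := 1 / 2) (by norm_num) hp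
    rw [show (1 / 2 - 1 : ℝ) = -(1 / 2) by norm_num, Real.Gamma_one_half_eq,
      ← Real.sqrt_eq_rpow, ← Real.sqrt_mul (by positivity)] at this
    rw [this]
    congr 1
    ring
  rw [← hv]
  refine tendsto_integral_filter_of_dominated_convergence _
    (Eventually.of_forall fun c => aestronglyMeasurable_expKer _ _ _) ?_ hi ?_
  · filter_upwards [self_mem_nhdsWithin] with c hc
    have hc : 0 < c := hc
    filter_upwards [ae_restrict_mem measurableSet_Ioi] with s hs
    have hs : 0 < s := hs
    rw [Real.norm_of_nonneg (expKer_nonneg _ _ _ hs)]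
    unfold expKer
    gcongr
    have : 0 < c / s := by positivity
    linarith
  · filter_upwards [ae_restrict_mem measurableSet_Ioi] with s hs
    have : Tendsto (fun c : ℝ => s ^ (-(1 / 2) : ℝ) * Real.exp (-(p * s) - c / s)) (𝓝 0)
        (𝓝 (s ^ (-(1 / 2) : ℝ) * Real.exp (-(p * s) - 0 / s))) := by
      apply Continuous.tendsto
      fun_prop
    rw [zero_div, sub_zero] at this
    exact this.mono_left nhdsWithin_le_nhds

/-- The two exchanges of p and c give f' = -√(p/c) f for f = `expInt (1 / 2) p`. Hence f(c)
exp(2√p√c) is constant on c > 0, and its value is read off as c → 0⁺. -/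
lemma expInt_half {p c : ℝ} (hp : 0 < p) (hc : 0 < c) :
    expInt (1 / 2) p c = Real.sqrt (Real.pi / p) * Real.exp (-(2 * Real.sqrt p * Real.sqrt c)) := by
  set φ : ℝ → ℝ := fun c => expInt (1 / 2) p c * Real.exp (2 * Real.sqrt p * Real.sqrt c) with hφ
  have hd : ∀ x : ℝ, 0 < x → HasDerivAt φ 0 x := by
    intro x hx
    have h1 := hasDerivAt_expInt (ν := 1 / 2) (Or.inl ⟨hp, by norm_num⟩) hx
    have h2 := (((Real.hasDerivAt_sqrt hx.ne').const_mul (2 * Real.sqrt p))).exp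
    refine (h1.mul h2).congr_deriv ?_
    have hs := expInt_swap hp hx
    rw [← expInt_half_eq_swap] at hs
    have hx' : 0 < Real.sqrt x := Real.sqrt_pos.mpr hx
    rw [show (1 / 2 + 1 : ℝ) = 3 / 2 by norm_num]
    have : expInt (3 / 2) p x = Real.sqrt p * expInt (1 / 2) p x / Real.sqrt x := by
      rw [hs]; field_simp
    rw [this]
    field_simp
    ring
  have hconst : ∀ x : ℝ, 0 < x → φ x = φ c := by
    intro x hx
    exact isOpen_Ioi.is_const_of_deriv_eq_zero (s := Set.Ioi (0 : ℝ)) isPreconnected_Ioi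
      (fun y hy => (hd y hy).differentiableAt.differentiableWithinAt)
      (fun y hy => (hd y hy).deriv) hx hc
  have hlim : Tendsto φ (𝓝[>] 0) (𝓝 (Real.sqrt (Real.pi / p) * 1)) := by
    refine (tendsto_expInt_half hp).mul ?_
    have : Tendsto (fun c : ℝ => Real.exp (2 * Real.sqrt p * Real.sqrt c)) (𝓝 0)
        (𝓝 (Real.exp (2 * Real.sqrt p * Real.sqrt 0))) := by
      apply Continuous.tendsto
      fun_prop
    rw [Real.sqrt_zero, mul_zero, Real.exp_zero] at this
    exact this.mono_left nhdsWithin_le_nhds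
  have hc2 : Tendsto φ (𝓝[>] 0) (𝓝 (φ c)) := by
    refine tendsto_const_nhds.congr' ?_
    filter_upwards [self_mem_nhdsWithin] with x hx using (hconst x hx).symm
  have := tendsto_nhds_unique hc2 hlim
  rw [mul_one] at this
  rw [← this, hφ, mul_assoc, ← Real.exp_add, add_neg_cancel, Real.exp_zero, mul_one]

lemma expInt_three_halves {p c : ℝ} (hp : 0 ≤ p) (hc : 0 < c) :
    expInt (3 / 2) p c =
      Real.sqrt Real.pi / Real.sqrt c * Real.exp (-(2 * Real.sqrt p * Real.sqrt c)) := by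
  have hc' : 0 < Real.sqrt c := Real.sqrt_pos.mpr hc
  rcases hp.eq_or_lt with rfl | hp
  · rw [expInt_zero (by norm_num) hc, show (3 / 2 - 1 : ℝ) = 1 / 2 by norm_num,
      Real.Gamma_one_half_eq, ← Real.sqrt_eq_rpow, Real.sqrt_div zero_le_one]
    simp
    ring
  · have hs := expInt_swap hp hc
    have hp' : 0 < Real.sqrt p := Real.sqrt_pos.mpr hp
    rw [← expInt_half_eq_swap, expInt_half hp hc, Real.sqrt_div Real.pi_pos.le] at hs
    field_simp at hs ⊢
    linarith

/-- Obtained by differentiating the closed form of order 3/2 in c. -/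
lemma expInt_five_halves {p c : ℝ} (hp : 0 ≤ p) (hc : 0 < c) :
    expInt (5 / 2) p c =
      Real.sqrt Real.pi * (1 / (2 * c * Real.sqrt c) + Real.sqrt p / c) *
        Real.exp (-(2 * Real.sqrt p * Real.sqrt c)) := by
  have hc' : 0 < Real.sqrt c := Real.sqrt_pos.mpr hc
  have h1 := hasDerivAt_expInt (ν := 3 / 2) (p := p) (Or.inr ⟨hp, by norm_num⟩) hc
  rw [show (3 / 2 + 1 : ℝ) = 5 / 2 by norm_num] at h1
  have h2 := (((hasDerivAt_const c (Real.sqrt Real.pi)).div (Real.hasDerivAt_sqrt hc.ne')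
    hc'.ne')).mul (((Real.hasDerivAt_sqrt hc.ne').const_mul (2 * Real.sqrt p)).neg.exp)
  have h3 := h2.congr_of_eventuallyEq (f₁ := expInt (3 / 2) p) (by
    filter_upwards [Ioi_mem_nhds hc] with x hx
    exact expInt_three_halves hp hx)
  have := h1.unique h3
  rw [neg_eq_iff_eq_neg] at this
  rw [this]
  have hcc : c = Real.sqrt c ^ 2 := (Real.sq_sqrt hc.le).symm
  simp only [Pi.div_apply, Pi.neg_apply]
  generalize Real.sqrt c = r at *
  subst hcc
  field_simp
  ring

/-! ### The modified Stokeslet in terms of these integrals -/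

lemma expInt_two_zero {c : ℝ} (hc : 0 < c) : expInt 2 0 c = 1 / c := by
  rw [expInt_zero (by norm_num) hc]
  norm_num

lemma expInt_three_zero {c : ℝ} (hc : 0 < c) : expInt 3 0 c = 1 / c ^ 2 := by
  rw [expInt_zero (by norm_num) hc, show (3 - 1 : ℝ) = ((1 : ℕ) : ℝ) + 1 by norm_num,
    Real.Gamma_nat_eq_factorial]
  norm_num [Real.rpow_ofNat]

/-- The substitution s ↦ β² s moves β out of c and into p, so that c depends on r alone. -/
lemma besselK0_eq {β r : ℝ} (hβ : 0 < β) :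
    besselK0 (β * r) = 1 / 2 * expInt 1 (β ^ 2) (r ^ 2 / 4) := by
  have hb : 0 < β ^ 2 := by positivity
  have h := integral_comp_mul_left_Ioi
    (fun s => Real.exp (-s - (β * r) ^ 2 / (4 * s)) / s) 0 hb
  rw [mul_zero, smul_eq_mul] at h
  unfold besselK0 expInt
  congr 1
  rw [← mul_right_inj' (inv_ne_zero hb.ne'), ← h, ← integral_const_mul]
  refine setIntegral_congr_fun measurableSet_Ioi fun s hs => ?_
  have hs : 0 < s := hs
  unfold expKer
  rw [Real.rpow_neg_one]
  have : -(β ^ 2 * s) - (β * r) ^ 2 / (4 * (β ^ 2 * s)) = -(β ^ 2 * s) - r ^ 2 / 4 / s := by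
    field_simp
  simp only [this]
  field_simp

/-- First radial derivative (in `ρ = r²`) of `K₀(β r) + log r`. -/
def radialD1 (β ρ : ℝ) : ℝ := (expInt 2 0 (ρ / 4) - expInt 2 (β ^ 2) (ρ / 4)) / 8

/-- Second radial derivative (in `ρ = r²`) of `K₀(β r) + log r`. -/
def radialD2 (β ρ : ℝ) : ℝ := -(expInt 3 0 (ρ / 4) - expInt 3 (β ^ 2) (ρ / 4)) / 32

/-- `K₀(β r) + log r` as a function of `ρ = r²`. -/
def radialD0 (β ρ : ℝ) : ℝ := 1 / 2 * expInt 1 (β ^ 2) (ρ / 4) + 1 / 2 * Real.log ρ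

lemma greenMB_eq {β x y : ℝ} (hβ : 0 < β) :
    greenMB β x y = -(1 / (2 * Real.pi * β ^ 2)) * radialD0 β (x ^ 2 + y ^ 2) := by
  have h : 0 ≤ x ^ 2 + y ^ 2 := by positivity
  unfold greenMB radialD0
  rw [besselK0_eq hβ, Real.sq_sqrt h, one_div (Real.sqrt _), Real.log_inv, Real.log_sqrt h]
  ring

lemma hasDerivAt_radialD0 {β ρ : ℝ} (hβ : 0 < β) (hρ : 0 < ρ) :
    HasDerivAt (radialD0 β) (radialD1 β ρ) ρ := by
  have hb : 0 < β ^ 2 := by positivity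
  have h1 := (hasDerivAt_expInt (ν := 1) (p := β ^ 2) (c := ρ / 4) (Or.inl ⟨hb, by norm_num⟩)
    (by positivity)).comp ρ ((hasDerivAt_id ρ).div_const 4)
  have h2 := (h1.const_mul (1 / 2)).add ((Real.hasDerivAt_log hρ.ne').const_mul (1 / 2))
  refine h2.congr_deriv ?_
  unfold radialD1
  rw [expInt_two_zero (by positivity), show (1 + 1 : ℝ) = 2 by norm_num]
  field_simp
  ring

lemma hasDerivAt_radialD1 {β ρ : ℝ} (hρ : 0 < ρ) :
    HasDerivAt (radialD1 β) (radialD2 β ρ) ρ := by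
  have h : ∀ p : ℝ, 0 ≤ p → HasDerivAt (fun ρ => expInt 2 p (ρ / 4))
      (-expInt (2 + 1) p (ρ / 4) * (1 / 4)) ρ := fun p hp =>
    HasDerivAt.comp (h₂ := expInt 2 p) (h := fun ρ => ρ / 4) ρ
      (hasDerivAt_expInt (Or.inr ⟨hp, by norm_num⟩) (by positivity))
      ((hasDerivAt_id ρ).div_const 4)
  refine (((h 0 le_rfl).sub (h (β ^ 2) (by positivity))).div_const 8).congr_deriv ?_
  unfold radialD2
  rw [show (2 + 1 : ℝ) = 3 by norm_num]
  ring

lemma hasDerivAt_greenMB_snd {β x y : ℝ} (hβ : 0 < β) (h : 0 < x ^ 2 + y ^ 2) :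
    HasDerivAt (fun y => greenMB β x y)
      (-(1 / (2 * Real.pi * β ^ 2)) * (radialD1 β (x ^ 2 + y ^ 2) * (2 * y))) y := by
  have h1 := ((hasDerivAt_radialD0 hβ h).comp y
    (((hasDerivAt_pow 2 y)).const_add (x ^ 2))).const_mul (-(1 / (2 * Real.pi * β ^ 2)))
  rw [show (fun y => greenMB β x y) = _ from funext fun y => greenMB_eq hβ]
  refine h1.congr_deriv ?_
  simp

lemma hasDerivAt_greenMB_fst {β x y : ℝ} (hβ : 0 < β) (h : 0 < x ^ 2 + y ^ 2) :
    HasDerivAt (fun x => greenMB β x y)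
      (-(1 / (2 * Real.pi * β ^ 2)) * (radialD1 β (x ^ 2 + y ^ 2) * (2 * x))) x := by
  have h1 := ((hasDerivAt_radialD0 hβ h).comp x
    (((hasDerivAt_pow 2 x)).add_const (y ^ 2))).const_mul (-(1 / (2 * Real.pi * β ^ 2)))
  rw [show (fun x => greenMB β x y) = _ from funext fun x => greenMB_eq hβ]
  refine h1.congr_deriv ?_
  simp

lemma hasDerivAt_radialD1_snd {β x y : ℝ} (h : 0 < x ^ 2 + y ^ 2) :
    HasDerivAt (fun y => radialD1 β (x ^ 2 + y ^ 2))
      (radialD2 β (x ^ 2 + y ^ 2) * (2 * y)) y := by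
  refine ((hasDerivAt_radialD1 h).comp y
    (((hasDerivAt_pow 2 y)).const_add (x ^ 2))).congr_deriv ?_
  simp

lemma hasDerivAt_radialD1_fst {β x y : ℝ} (h : 0 < x ^ 2 + y ^ 2) :
    HasDerivAt (fun x => radialD1 β (x ^ 2 + y ^ 2))
      (radialD2 β (x ^ 2 + y ^ 2) * (2 * x)) x := by
  refine ((hasDerivAt_radialD1 h).comp x
    (((hasDerivAt_pow 2 x)).add_const (y ^ 2))).congr_deriv ?_
  simp

lemma modifiedStokeslet_zero_zero {β x y : ℝ} (hβ : 0 < β) (hy : 0 < y) :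
    modifiedStokeslet β (x, y) 0 0 = 1 / (2 * Real.pi * β ^ 2) *
      (2 * radialD1 β (x ^ 2 + y ^ 2) + 4 * y ^ 2 * radialD2 β (x ^ 2 + y ^ 2)) := by
  have e : (fun y => deriv (fun y' => greenMB β x y') y) =ᶠ[𝓝 y] fun y =>
      -(1 / (2 * Real.pi * β ^ 2)) * (radialD1 β (x ^ 2 + y ^ 2) * (2 * y)) := by
    filter_upwards [Ioi_mem_nhds hy] with y' hy'
    have hy' : 0 < y' := hy'
    exact (hasDerivAt_greenMB_snd hβ (by positivity)).deriv
  have h := ((hasDerivAt_radialD1_snd (β := β) (x := x) (y := y) (by positivity)).mul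
    ((hasDerivAt_id y).const_mul 2)).const_mul (-(1 / (2 * Real.pi * β ^ 2)))
  have h2 := (h.congr_of_eventuallyEq e).deriv
  change -(deriv (fun y => deriv (fun y' => greenMB β x y') y) y) = _
  rw [h2]
  simp only [id]
  ring

lemma modifiedStokeslet_zero_one {β x y : ℝ} (hβ : 0 < β) (hy : 0 < y) :
    modifiedStokeslet β (x, y) 0 1 = -(1 / (2 * Real.pi * β ^ 2)) *
      (4 * x * y * radialD2 β (x ^ 2 + y ^ 2)) := by
  have e : (fun x => deriv (fun y => greenMB β x y) y) = fun x =>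
      -(1 / (2 * Real.pi * β ^ 2)) * (radialD1 β (x ^ 2 + y ^ 2) * (2 * y)) :=
    funext fun x' => (hasDerivAt_greenMB_snd hβ (by positivity)).deriv
  have h := ((hasDerivAt_radialD1_fst (β := β) (x := x) (y := y) (by positivity)).mul_const
    (2 * y)).const_mul (-(1 / (2 * Real.pi * β ^ 2)))
  rw [← e] at h
  change deriv (fun x => deriv (fun y => greenMB β x y) y) x = _
  rw [h.deriv]
  ring

/-- The trace of the Stokeslet is -ΔG_β = K₀(β r)/(2π): the logarithm is harmonic and the Bessel
recurrence gives ΔK₀(β r) = β² K₀(β r). The last entry thus follows from the first. -/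
lemma modifiedStokeslet_one_one {β x y : ℝ} (hβ : 0 < β) (hy : 0 < y) :
    modifiedStokeslet β (x, y) 1 1 = 1 / (4 * Real.pi) * expInt 1 (β ^ 2) ((x ^ 2 + y ^ 2) / 4) -
      modifiedStokeslet β (x, y) 0 0 := by
  have hρ : 0 < (x ^ 2 + y ^ 2) / 4 := by positivity
  have e : (fun x => deriv (fun x' => greenMB β x' y) x) = fun x =>
      -(1 / (2 * Real.pi * β ^ 2)) * (radialD1 β (x ^ 2 + y ^ 2) * (2 * x)) :=
    funext fun x' => (hasDerivAt_greenMB_fst hβ (by positivity)).deriv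
  have h := ((hasDerivAt_radialD1_fst (β := β) (x := x) (y := y) (by positivity)).mul
    ((hasDerivAt_id x).const_mul 2)).const_mul (-(1 / (2 * Real.pi * β ^ 2)))
  have h' : modifiedStokeslet β (x, y) 1 1 = 1 / (2 * Real.pi * β ^ 2) *
      (2 * radialD1 β (x ^ 2 + y ^ 2) + 4 * x ^ 2 * radialD2 β (x ^ 2 + y ^ 2)) := by
    change -(deriv (fun x => deriv (fun x' => greenMB β x' y) x) x) = _
    have h2 : HasDerivAt (fun x => -(1 / (2 * Real.pi * β ^ 2)) *
        (radialD1 β (x ^ 2 + y ^ 2) * (2 * x))) _ x := h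
    rw [e, h2.deriv]
    simp only [id]
    ring
  rw [h', modifiedStokeslet_zero_zero hβ hy]
  unfold radialD1 radialD2
  have r := expInt_recurrence (p := β ^ 2) (by positivity) hρ
  have r2 := expInt_two_zero hρ
  have r3 := expInt_three_zero hρ
  have r4 : expInt 1 (β ^ 2) ((x ^ 2 + y ^ 2) / 4) = ((x ^ 2 + y ^ 2) / 4 *
    expInt 3 (β ^ 2) ((x ^ 2 + y ^ 2) / 4) - expInt 2 (β ^ 2) ((x ^ 2 + y ^ 2) / 4)) / β ^ 2 := by
    rw [r]; field_simp; ring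
  rw [r2, r3, r4]
  have : x ^ 2 + y ^ 2 ≠ 0 := by positivity
  field_simp
  ring

/-! ### Fourier transform in the horizontal variable -/

lemma expKer_split (ν p d z x : ℝ) (s : ℝ) :
    expKer ν p (((d * x) ^ 2 + z ^ 2) / 4) s =
      expKer ν p (z ^ 2 / 4) s * Real.exp (-(d ^ 2 / (4 * s)) * x ^ 2) := by
  unfold expKer
  rw [mul_assoc, ← Real.exp_add]
  congr 2
  ring

/-- The transform of the Gaussian with b = d²/(4s) contributes √(π/b), a multiple of √s, which
lowers ν by 1/2, and exp(-(2πw)²/(4b)), which adds (2πw/d)² to p. -/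
lemma expKer_mul_sqrt (ν p c d w : ℝ) {s : ℝ} (hd : 0 < d) (hs : 0 < s) :
    expKer ν p c s * (Real.sqrt (Real.pi / (d ^ 2 / (4 * s))) *
      Real.exp (-(2 * Real.pi * w) ^ 2 / (4 * (d ^ 2 / (4 * s))))) =
    2 * Real.sqrt Real.pi / d * expKer (ν - 1 / 2) (p + (2 * Real.pi * w / d) ^ 2) c s := by
  have h1 : Real.sqrt (Real.pi / (d ^ 2 / (4 * s))) = 2 * Real.sqrt Real.pi / d * Real.sqrt s := by
    rw [show Real.pi / (d ^ 2 / (4 * s)) = (2 / d) ^ 2 * (Real.pi * s) by field_simp; ring,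
      Real.sqrt_mul (by positivity), Real.sqrt_sq (by positivity), Real.sqrt_mul Real.pi_pos.le]
    ring
  have h2 : s ^ (-(ν - 1 / 2)) = s ^ (-ν) * Real.sqrt s := by
    rw [Real.sqrt_eq_rpow, ← Real.rpow_add hs]; congr 1; ring
  unfold expKer
  rw [h1, h2]
  have h3 : Real.exp (-((p + (2 * Real.pi * w / d) ^ 2) * s) - c / s) =
      Real.exp (-(p * s) - c / s) *
        Real.exp (-(2 * Real.pi * w) ^ 2 / (4 * (d ^ 2 / (4 * s)))) := by
    rw [← Real.exp_add]; congr 1; field_simp; ring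
  rw [h3]
  ring

/-- The hypothesis of Fubini for exchanging the Fourier integral with the s-integral. The
oscillating factor has modulus one, so the x-integral of the modulus is the frequency-zero Gaussian
computation. -/
lemma integrable_fourierKernel {ν p d z : ℝ} (hd : 0 < d) (hz : 0 < z)
    (h : (0 < p ∧ 0 < ν - 1 / 2) ∨ (0 ≤ p ∧ 1 < ν - 1 / 2)) (w : ℝ) :
    Integrable (fun q : ℝ × ℝ => Complex.exp (((-2 * Real.pi * q.1 * w : ℝ) : ℂ) * Complex.I) *
      ((expKer ν p (((d * q.1) ^ 2 + z ^ 2) / 4) q.2 : ℝ) : ℂ))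
      (volume.prod (volume.restrict (Set.Ioi (0 : ℝ)))) := by
  have hc : 0 < z ^ 2 / 4 := by positivity
  have hn : ∀ x s : ℝ, ‖Complex.exp (((-2 * Real.pi * x * w : ℝ) : ℂ) * Complex.I) *
      ((expKer ν p (((d * x) ^ 2 + z ^ 2) / 4) s : ℝ) : ℂ)‖ =
      |expKer ν p (z ^ 2 / 4) s| * Real.exp (-(d ^ 2 / (4 * s)) * x ^ 2) := by
    intro x s
    rw [norm_mul, Complex.norm_exp_ofReal_mul_I, one_mul, Complex.norm_real, expKer_split,
      Real.norm_eq_abs, abs_mul, abs_of_pos (Real.exp_pos _)]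
  have hm : Measurable (fun q : ℝ × ℝ =>
      Complex.exp (((-2 * Real.pi * q.1 * w : ℝ) : ℂ) * Complex.I) *
      ((expKer ν p (((d * q.1) ^ 2 + z ^ 2) / 4) q.2 : ℝ) : ℂ)) := by
    unfold expKer
    fun_prop
  rw [integrable_prod_iff' hm.aestronglyMeasurable]
  constructor
  · filter_upwards [ae_restrict_mem measurableSet_Ioi] with s hs
    have hs : 0 < s := hs
    have hb : 0 < d ^ 2 / (4 * s) := by positivity
    refine Integrable.mono' ((integrable_exp_neg_mul_sq hb).const_mul |expKer ν p (z ^ 2 / 4) s|)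
      (hm.comp measurable_prodMk_right).aestronglyMeasurable (Eventually.of_forall fun x => ?_)
    exact (hn x s).le
  · simp_rw [hn, integral_const_mul, integral_gaussian]
    refine ((integrableOn_expKer h hc).const_mul (2 * Real.sqrt Real.pi / d)).congr ?_
    filter_upwards [ae_restrict_mem measurableSet_Ioi] with s hs
    have := expKer_mul_sqrt ν p (z ^ 2 / 4) d 0 hd hs
    rw [abs_of_nonneg (expKer_nonneg _ _ _ hs)]
    simpa using this.symm

lemma integrable_expInt {ν p d z : ℝ} (hd : 0 < d) (hz : 0 < z)
    (h : (0 < p ∧ 0 < ν - 1 / 2) ∨ (0 ≤ p ∧ 1 < ν - 1 / 2)) :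
    Integrable (fun x : ℝ => ((expInt ν p (((d * x) ^ 2 + z ^ 2) / 4) : ℝ) : ℂ)) := by
  have := (integrable_fourierKernel hd hz h 0).integral_prod_left
  refine this.congr (Eventually.of_forall fun x => ?_)
  simp only [mul_zero, Complex.ofReal_zero, zero_mul, Complex.exp_zero, one_mul]
  exact integral_ofReal

lemma fourier_expInt {ν p d z : ℝ} (hd : 0 < d) (hz : 0 < z)
    (h : (0 < p ∧ 0 < ν - 1 / 2) ∨ (0 ≤ p ∧ 1 < ν - 1 / 2)) (w : ℝ) :
    𝓕 (fun x : ℝ => ((expInt ν p (((d * x) ^ 2 + z ^ 2) / 4) : ℝ) : ℂ)) w =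
      ((2 * Real.sqrt Real.pi / d *
        expInt (ν - 1 / 2) (p + (2 * Real.pi * w / d) ^ 2) (z ^ 2 / 4) : ℝ) : ℂ) := by
  rw [Real.fourier_real_eq_integral_exp_smul]
  have e : ∀ x : ℝ, Complex.exp (((-2 * Real.pi * x * w : ℝ) : ℂ) * Complex.I) •
      ((expInt ν p (((d * x) ^ 2 + z ^ 2) / 4) : ℝ) : ℂ) =
      ∫ s in Set.Ioi (0 : ℝ), Complex.exp (((-2 * Real.pi * x * w : ℝ) : ℂ) * Complex.I) *
      ((expKer ν p (((d * x) ^ 2 + z ^ 2) / 4) s : ℝ) : ℂ) := by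
    intro x
    rw [integral_const_mul, integral_complex_ofReal, smul_eq_mul]
    rfl
  simp_rw [e]
  rw [integral_integral_swap (integrable_fourierKernel hd hz h w)]
  unfold expInt
  rw [← integral_const_mul, ← integral_complex_ofReal]
  refine setIntegral_congr_fun measurableSet_Ioi fun s hs => ?_
  have hs : 0 < s := hs
  have hb : 0 < d ^ 2 / (4 * s) := by positivity
  have hg := fourierIntegral_gaussian (b := ((d ^ 2 / (4 * s) : ℝ) : ℂ)) (by rwa [Complex.ofReal_re])
    ((-(2 * Real.pi * w) : ℝ) : ℂ)
  rw [← expKer_mul_sqrt ν p _ d w hd hs]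
  have e2 : ∀ x : ℝ, Complex.exp (((-2 * Real.pi * x * w : ℝ) : ℂ) * Complex.I) *
      ((expKer ν p (((d * x) ^ 2 + z ^ 2) / 4) s : ℝ) : ℂ) =
      ((expKer ν p (z ^ 2 / 4) s : ℝ) : ℂ) *
      (Complex.exp (Complex.I * ((-(2 * Real.pi * w) : ℝ) : ℂ) * x) *
        Complex.exp (-((d ^ 2 / (4 * s) : ℝ) : ℂ) * x ^ 2)) := by
    intro x
    rw [expKer_split]
    have : ((-2 * Real.pi * x * w : ℝ) : ℂ) * Complex.I =
      Complex.I * ((-(2 * Real.pi * w) : ℝ) : ℂ) * x := by push_cast; ring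
    rw [this]
    push_cast
    ring
  simp_rw [e2]
  rw [integral_const_mul, hg, Complex.ofReal_mul, Complex.ofReal_mul, Real.sqrt_eq_rpow,
    Complex.ofReal_cpow (by positivity)]
  push_cast
  congr 3
  ring

lemma continuous_expInt_comp {ν p : ℝ} (h : (0 < p ∧ 0 < ν) ∨ (0 ≤ p ∧ 1 < ν)) {z : ℝ}
    (hz : 0 < z) (d : ℝ) : Continuous fun x : ℝ => expInt ν p (((d * x) ^ 2 + z ^ 2) / 4) :=
  (continuousOn_expInt h).comp_continuous (by fun_prop) fun x =>
    Set.mem_Ioi.mpr (by positivity)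

lemma hasDerivAt_expInt_two_comp {p : ℝ} (hp : 0 ≤ p) {z : ℝ} (hz : 0 < z) (d x : ℝ) :
    HasDerivAt (fun x : ℝ => expInt 2 p (((d * x) ^ 2 + z ^ 2) / 4))
      (-(d ^ 2 * x / 2 * expInt 3 p (((d * x) ^ 2 + z ^ 2) / 4))) x := by
  have h1 : HasDerivAt (fun x : ℝ => ((d * x) ^ 2 + z ^ 2) / 4) (d ^ 2 * x / 2) x := by
    refine ((((hasDerivAt_id x).const_mul d).pow 2).add_const (z ^ 2)).div_const 4
      |>.congr_deriv ?_
    simp; ring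
  have h2 := HasDerivAt.comp (h₂ := expInt 2 p) x
    (hasDerivAt_expInt (ν := 2) (c := ((d * x) ^ 2 + z ^ 2) / 4)
      (Or.inr ⟨hp, by norm_num⟩) (by positivity)) h1
  refine h2.congr_deriv ?_
  rw [show (2 + 1 : ℝ) = 3 by norm_num]
  ring

/-! ### Poisson summation over the images in a row -/

/-- The two series converge (absolutely, over `ℤ`) and have the same sum. -/
def SameSum (u v : ℤ → ℂ) : Prop := ∃ S, HasSum u S ∧ HasSum v S

lemma SameSum.add {u v u' v' : ℤ → ℂ} (h : SameSum u v) (h' : SameSum u' v') :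
    SameSum (fun m => u m + u' m) (fun m => v m + v' m) := by
  obtain ⟨S, h1, h2⟩ := h
  obtain ⟨S', h1', h2'⟩ := h'
  exact ⟨S + S', h1.add h1', h2.add h2'⟩

lemma SameSum.const_mul {u v : ℤ → ℂ} (h : SameSum u v) (c : ℂ) :
    SameSum (fun m => c * u m) (fun m => c * v m) := by
  obtain ⟨S, h1, h2⟩ := h
  exact ⟨c * S, h1.mul_left c, h2.mul_left c⟩

lemma SameSum.congr {u v u' v' : ℤ → ℂ} (h : SameSum u v) (hu : ∀ m, u' m = u m)
    (hv : ∀ m, v' m = v m) : SameSum u' v' := by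
  rwa [show u' = u from funext hu, show v' = v from funext hv]

lemma summable_int_of_nat_abs {f : ℕ → ℝ} (h : Summable f) :
    Summable fun n : ℤ => f n.natAbs :=
  Summable.of_nat_of_neg (by simpa using h) (by simpa using h)

lemma summable_int_pow_mul_exp {κ : ℝ} (hκ : 0 < κ) (k : ℕ) :
    Summable fun n : ℤ => |(n : ℝ)| ^ k * Real.exp (-(κ * |(n : ℝ)|)) := by
  have h := summable_int_of_nat_abs (f := fun n : ℕ => (n : ℝ) ^ k * Real.exp (-κ) ^ n)
    (summable_pow_mul_geometric_of_norm_lt_one k (by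
      rw [Real.norm_of_nonneg (Real.exp_pos _).le]
      rw [Real.exp_lt_one_iff]; linarith))
  refine h.congr fun n => ?_
  rw [← Real.exp_nat_mul, Nat.cast_natAbs, Int.cast_abs]
  congr 2
  ring

lemma abs_alpha {d : ℝ} (hd : 0 < d) (n : ℤ) : |alpha d n| = 2 * Real.pi / d * |(n : ℝ)| := by
  unfold alpha
  rw [mul_div_right_comm, abs_mul, abs_of_pos (by positivity)]

lemma summable_alpha_pow_mul_exp {d κ : ℝ} (hd : 0 < d) (hκ : 0 < κ) (k : ℕ) :
    Summable fun n : ℤ => |alpha d n| ^ k * Real.exp (-(κ * |alpha d n|)) := by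
  have h := (summable_int_pow_mul_exp (κ := κ * (2 * Real.pi / d)) (by positivity) k).mul_left
    ((2 * Real.pi / d) ^ k)
  refine h.congr fun n => ?_
  rw [abs_alpha hd, mul_pow]
  ring_nf

/-- By the arithmetic-geometric inequality, a² s + z²/(16 s) ≥ |a| z/2. Part of the exponent z²/(4s)
is spent on this, and z²/(8s) is kept for convergence. It gives the exponential decay of the Fourier
coefficients. -/
lemma expInt_add_sq_le {ν p z : ℝ} (h : (0 < p ∧ 0 < ν) ∨ (0 ≤ p ∧ 1 < ν)) (hz : 0 < z) (a : ℝ) :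
    expInt ν (p + a ^ 2) (z ^ 2 / 4) ≤ Real.exp (-(z / 2 * |a|)) * expInt ν p (z ^ 2 / 8) := by
  unfold expInt
  rw [← integral_const_mul]
  have h' : (0 < p + a ^ 2 ∧ 0 < ν) ∨ (0 ≤ p + a ^ 2 ∧ 1 < ν) := by
    rcases h with ⟨hp, hν⟩ | ⟨hp, hν⟩
    · exact Or.inl ⟨by positivity, hν⟩
    · exact Or.inr ⟨by positivity, hν⟩
  refine setIntegral_mono_on (integrableOn_expKer h' (by positivity))
    ((integrableOn_expKer h (by positivity)).const_mul _) measurableSet_Ioi fun s hs => ?_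
  have hs : 0 < s := hs
  unfold expKer
  rw [mul_left_comm, ← Real.exp_add]
  gcongr
  have h2 : 0 ≤ (|a| * s - z / 4) ^ 2 / s := by positivity
  have h3 : (|a| * s - z / 4) ^ 2 / s = a ^ 2 * s - z / 2 * |a| + z ^ 2 / 16 / s := by
    rw [← sq_abs a]; field_simp; ring
  have h4 : 0 ≤ z ^ 2 / 16 / s := by positivity
  have h5 : z ^ 2 / 4 / s = 2 * (z ^ 2 / 16 / s) + z ^ 2 / 8 / s := by field_simp; ring
  nlinarith

lemma sameSum_poisson {f : ℝ → ℂ} (hf : Continuous f) {d z A : ℝ} (hd : 0 < d) (hz : 0 < z)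
    (hA : 0 ≤ A) (hb : ∀ x, ‖f x‖ ≤ A / ((d * x) ^ 2 + z ^ 2))
    (hF : Summable fun n : ℤ => 𝓕 f (n : ℝ)) (X : ℝ) :
    SameSum (fun m : ℤ => f (X / d - m))
      (fun n : ℤ => 𝓕 f (n : ℝ) * Complex.exp (Complex.I * ((alpha d n * X : ℝ) : ℂ))) := by
  have hO : f =O[cocompact ℝ] fun x : ℝ => |x| ^ (-2 : ℝ) := by
    refine Asymptotics.IsBigO.of_bound (A / d ^ 2) ?_
    have : ∀ᶠ x : ℝ in cocompact ℝ, x ≠ 0 := by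
      have := (Set.finite_singleton (0 : ℝ)).isCompact.compl_mem_cocompact
      filter_upwards [this] with x hx using hx
    filter_upwards [this] with x hx
    refine (hb x).trans ?_
    rw [Real.norm_of_nonneg (by positivity), Real.rpow_neg (abs_nonneg _), Real.rpow_two, sq_abs]
    have h1 : 0 < x ^ 2 := by positivity
    calc A / ((d * x) ^ 2 + z ^ 2) ≤ A / (d ^ 2 * x ^ 2) := by
          gcongr
          rw [mul_pow]; nlinarith
      _ = _ := by field_simp
  have hs : Summable fun m : ℤ => f (X / d + m) := by
    -- With y = X/d, the constant comes from n² ≤ 2(y + n)² + 2y², its two terms being compared with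
    -- the two terms of the denominator.
    have hs2 := ((Real.summable_one_div_int_pow (p := 2)).mpr one_lt_two).mul_left
      (A * (2 / d ^ 2 + (2 * (X / d) ^ 2 + 1) / z ^ 2))
    refine Summable.of_norm_bounded_eventually hs2 ?_
    filter_upwards [(Set.finite_singleton (0 : ℤ)).compl_mem_cofinite] with n hn
    have hn : (n : ℝ) ≠ 0 := by exact_mod_cast hn
    refine (hb _).trans ?_
    have hn2 : 0 < (n : ℝ) ^ 2 := by positivity
    set y := X / d with hy
    rw [mul_one_div, div_le_div_iff₀ (by positivity) hn2, mul_assoc]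
    gcongr
    have e : (2 / d ^ 2 + (2 * y ^ 2 + 1) / z ^ 2) * ((d * (y + n)) ^ 2 + z ^ 2) =
      2 * (y + n) ^ 2 + 2 * y ^ 2 + 1 + (2 / d ^ 2 * z ^ 2 +
        (2 * y ^ 2 + 1) / z ^ 2 * (d * (y + n)) ^ 2) := by
      field_simp; ring
    rw [e]
    have : 0 ≤ 2 / d ^ 2 * z ^ 2 + (2 * y ^ 2 + 1) / z ^ 2 * (d * (y + n)) ^ 2 := by positivity
    nlinarith [sq_nonneg (2 * y + n)]
  have key := Real.tsum_eq_tsum_fourier_of_rpow_decay_of_summable hf one_lt_two hO hF (X / d)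
  have hfo : ∀ n : ℤ, fourier n ((X / d : ℝ) : UnitAddCircle) =
      Complex.exp (Complex.I * ((alpha d n * X : ℝ) : ℂ)) := by
    intro n
    rw [fourier_coe_apply]
    congr 1
    unfold alpha
    push_cast
    field_simp
  simp_rw [hfo] at key
  refine ⟨∑' n : ℤ, f (X / d + n), ?_, ?_⟩
  · have := (Equiv.neg ℤ).hasSum_iff.mpr hs.hasSum
    refine this.congr_fun fun m => ?_
    simp [sub_eq_add_neg]
  · rw [key]
    refine Summable.hasSum (Summable.of_norm ?_)
    refine hF.norm.congr fun n => ?_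
    rw [norm_mul, mul_comm Complex.I, Complex.norm_exp_ofReal_mul_I, mul_one]

lemma two_pi_div_eq_alpha (d : ℝ) (n : ℤ) : 2 * Real.pi * (n : ℝ) / d = alpha d n := rfl

lemma summable_fourier_expInt {ν p d z : ℝ} (hd : 0 < d) (hz : 0 < z)
    (h : (0 < p ∧ 0 < ν - 1 / 2) ∨ (0 ≤ p ∧ 1 < ν - 1 / 2)) (k : ℕ) :
    Summable fun n : ℤ => |alpha d n| ^ k *
      |2 * Real.sqrt Real.pi / d * expInt (ν - 1 / 2) (p + alpha d n ^ 2) (z ^ 2 / 4)| := by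
  refine Summable.of_nonneg_of_le (fun n => by positivity) (fun n => ?_)
    ((summable_alpha_pow_mul_exp hd (half_pos hz) k).mul_left
      (2 * Real.sqrt Real.pi / d * expInt (ν - 1 / 2) p (z ^ 2 / 8)))
  rw [abs_of_nonneg (mul_nonneg (by positivity) (expInt_nonneg _ _ _))]
  have := expInt_add_sq_le h hz (alpha d n)
  calc _ ≤ |alpha d n| ^ k * (2 * Real.sqrt Real.pi / d *
        (Real.exp (-(z / 2 * |alpha d n|)) * expInt (ν - 1 / 2) p (z ^ 2 / 8))) := by gcongr
    _ = _ := by ring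

lemma sameSum_expInt {ν p A d z : ℝ} (hd : 0 < d) (hz : 0 < z)
    (h : (0 < p ∧ 0 < ν - 1 / 2) ∨ (0 ≤ p ∧ 1 < ν - 1 / 2)) (hA : 0 ≤ A)
    (hb : ∀ c, z ^ 2 / 4 ≤ c → expInt ν p c ≤ A / c) (X : ℝ) :
    SameSum (fun m : ℤ => ((expInt ν p (((X - m * d) ^ 2 + z ^ 2) / 4) : ℝ) : ℂ))
      (fun n : ℤ => ((2 * Real.sqrt Real.pi / d *
        expInt (ν - 1 / 2) (p + alpha d n ^ 2) (z ^ 2 / 4) : ℝ) : ℂ) *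
        Complex.exp (Complex.I * ((alpha d n * X : ℝ) : ℂ))) := by
  have h' : (0 < p ∧ 0 < ν) ∨ (0 ≤ p ∧ 1 < ν) := by
    rcases h with ⟨hp, hν⟩ | ⟨hp, hν⟩
    · exact Or.inl ⟨hp, by linarith⟩
    · exact Or.inr ⟨hp, by linarith⟩
  have key := sameSum_poisson (f := fun x : ℝ =>
      ((expInt ν p (((d * x) ^ 2 + z ^ 2) / 4) : ℝ) : ℂ)) (A := 4 * A)
    (Complex.continuous_ofReal.comp (continuous_expInt_comp h' hz d)) hd hz (by positivity)
    (fun x => ?_) ?_ X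
  · refine key.congr (fun m => ?_) (fun n => ?_)
    · congr 4
      field_simp
    · rw [fourier_expInt hd hz h, two_pi_div_eq_alpha]
  · rw [Complex.norm_real, Real.norm_of_nonneg (expInt_nonneg _ _ _)]
    refine (hb _ (by nlinarith [sq_nonneg (d * x)])).trans_eq ?_
    field_simp
  · refine Summable.of_norm ((summable_fourier_expInt hd hz h 0).congr fun n => ?_)
    rw [fourier_expInt hd hz h, two_pi_div_eq_alpha, Complex.norm_real, Real.norm_eq_abs, pow_zero,
      one_mul]

lemma expInt_three_le {p c : ℝ} (hp : 0 ≤ p) (hc : 0 < c) : expInt 3 p c ≤ 1 / c ^ 2 := by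
  have h := expInt_le (ν := 3) (by norm_num) hp hc
  rwa [← expInt_zero (by norm_num) hc, expInt_three_zero hc] at h

lemma expInt_two_le {p c : ℝ} (hp : 0 ≤ p) (hc : 0 < c) : expInt 2 p c ≤ 1 / c := by
  have h := expInt_le (ν := 2) (by norm_num) hp hc
  rwa [← expInt_zero (by norm_num) hc, expInt_two_zero hc] at h

/-- The summand is, up to the factor -2/d, the x-derivative of the order 2 integral, so its
transform is that of order 2 times 2πi n. This produces the odd factor α in the off-diagonal
entries. -/
lemma sameSum_mul_expInt_three {p d z : ℝ} (hd : 0 < d) (hz : 0 < z) (hp : 0 ≤ p) (X : ℝ) :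
    SameSum (fun m : ℤ => (((X - m * d) * expInt 3 p (((X - m * d) ^ 2 + z ^ 2) / 4) : ℝ) : ℂ))
      (fun n : ℤ => (-2 * Complex.I * (alpha d n : ℂ)) * ((2 * Real.sqrt Real.pi / d *
        expInt (2 - 1 / 2) (p + alpha d n ^ 2) (z ^ 2 / 4) : ℝ) : ℂ) *
        Complex.exp (Complex.I * ((alpha d n * X : ℝ) : ℂ))) := by
  have h : (0 < p ∧ (0 : ℝ) < 2 - 1 / 2) ∨ (0 ≤ p ∧ (1 : ℝ) < 2 - 1 / 2) :=
    Or.inr ⟨hp, by norm_num⟩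
  set f : ℝ → ℂ := fun x => ((expInt 2 p (((d * x) ^ 2 + z ^ 2) / 4) : ℝ) : ℂ) with hf
  have hd1 : ∀ x : ℝ, HasDerivAt f
      ((-(d ^ 2 * x / 2 * expInt 3 p (((d * x) ^ 2 + z ^ 2) / 4)) : ℝ) : ℂ) x := fun x =>
    (hasDerivAt_expInt_two_comp hp hz d x).ofReal_comp
  have hd2 : deriv f = fun x =>
      ((-(d ^ 2 * x / 2 * expInt 3 p (((d * x) ^ 2 + z ^ 2) / 4)) : ℝ) : ℂ) :=
    funext fun x => (hd1 x).deriv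
  have hcont : Continuous (deriv f) := by
    rw [hd2]
    have := continuous_expInt_comp (ν := 3) (p := p) (Or.inr ⟨hp, by norm_num⟩) hz d
    fun_prop
  have hbd : ∀ x, ‖deriv f x‖ ≤ (4 * d / z) / ((d * x) ^ 2 + z ^ 2) := by
    intro x
    rw [hd2, Complex.norm_real, norm_neg, norm_mul, Real.norm_of_nonneg (expInt_nonneg _ _ _)]
    have h3 := expInt_three_le hp (c := ((d * x) ^ 2 + z ^ 2) / 4) (by positivity)
    have h1 : ‖d ^ 2 * x / 2‖ = d / 2 * |d * x| := by
      rw [Real.norm_eq_abs, show d ^ 2 * x / 2 = d / 2 * (d * x) by ring, abs_mul,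
        abs_of_pos (half_pos hd)]
    have h2 : |d * x| ≤ ((d * x) ^ 2 + z ^ 2) / (2 * z) := by
      rw [le_div_iff₀ (by positivity), ← sq_abs (d * x)]
      nlinarith [sq_nonneg (|d * x| - z)]
    rw [h1]
    calc d / 2 * |d * x| * expInt 3 p (((d * x) ^ 2 + z ^ 2) / 4)
        ≤ d / 2 * (((d * x) ^ 2 + z ^ 2) / (2 * z)) * (1 / (((d * x) ^ 2 + z ^ 2) / 4) ^ 2) := by
          have := expInt_nonneg 3 p (((d * x) ^ 2 + z ^ 2) / 4)
          gcongr
      _ = _ := by field_simp; ring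
  have hint : Integrable (deriv f) := by
    -- The order 2 integral at p = 0 is exactly 4/((dx)² + z²), so it serves as integrable majorant.
    have h0 := (integrable_expInt (ν := 2) (p := 0) hd hz (Or.inr ⟨le_rfl, by norm_num⟩)).norm
    refine Integrable.mono' (h0.const_mul (d / z)) hcont.aestronglyMeasurable
      (Eventually.of_forall fun x => ?_)
    refine (hbd x).trans_eq ?_
    rw [Complex.norm_real, Real.norm_of_nonneg (expInt_nonneg _ _ _),
      expInt_two_zero (by positivity)]
    field_simp
  have hF : ∀ n : ℤ, 𝓕 (deriv f) (n : ℝ) = (2 * Real.pi * Complex.I * n) *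
      ((2 * Real.sqrt Real.pi / d *
        expInt (2 - 1 / 2) (p + alpha d n ^ 2) (z ^ 2 / 4) : ℝ) : ℂ) := by
    intro n
    rw [Real.fourier_deriv (integrable_expInt hd hz h) (fun x => (hd1 x).differentiableAt) hint]
    beta_reduce
    rw [smul_eq_mul, fourier_expInt hd hz h, two_pi_div_eq_alpha]
    simp
  have key := (sameSum_poisson (f := deriv f) hcont hd hz (by positivity) hbd ?_ X).const_mul
    (-2 / d)
  · refine key.congr (fun m => ?_) (fun n => ?_)
    · have : d * (X / d - m) = X - m * d := by field_simp
      rw [hd2]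
      simp only
      rw [this, show d ^ 2 * (X / d - m) / 2 = d / 2 * (X - m * d) by rw [← this]; ring]
      have : (d : ℂ) ≠ 0 := by exact_mod_cast hd.ne'
      push_cast
      field_simp
    · rw [hF]
      have : (d : ℂ) ≠ 0 := by exact_mod_cast hd.ne'
      have ha : (alpha d n : ℂ) = 2 * Real.pi * n / d := by unfold alpha; push_cast; ring
      rw [ha]
      field_simp
  · refine Summable.of_norm (((summable_fourier_expInt hd hz h 1).mul_left d).congr fun n => ?_)
    rw [hF, norm_mul, Complex.norm_real, Real.norm_eq_abs, pow_one, ← mul_assoc]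
    congr 1
    rw [abs_alpha hd]
    simp [abs_of_pos Real.pi_pos]
    field_simp

/-! ### Fourier series of a row of modified Stokeslets -/

/-- `χ_m = √(β² + α_m²)`. -/
def chi (d β : ℝ) (m : ℤ) : ℝ := Real.sqrt (β ^ 2 + alpha d m ^ 2)

/-- The `m`-th Fourier coefficient (in the direction of `e₁`) of one row of modified Stokeslets. -/
def rowMode (d β z : ℝ) (m : ℤ) : Block :=
  !![(((chi d β m * Real.exp (-(chi d β m * z)) - |alpha d m| * Real.exp (-(|alpha d m| * z))) /
        (2 * d * β ^ 2) : ℝ) : ℂ),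
      Complex.I * ((alpha d m * (Real.exp (-(chi d β m * z)) - Real.exp (-(|alpha d m| * z))) /
        (2 * d * β ^ 2) : ℝ) : ℂ);
      Complex.I * ((alpha d m * (Real.exp (-(chi d β m * z)) - Real.exp (-(|alpha d m| * z))) /
        (2 * d * β ^ 2) : ℝ) : ℂ),
      (((|alpha d m| * Real.exp (-(|alpha d m| * z)) -
        alpha d m ^ 2 / chi d β m * Real.exp (-(chi d β m * z))) / (2 * d * β ^ 2) : ℝ) : ℂ)]

lemma chi_pos {β : ℝ} (d : ℝ) (hβ : 0 < β) (m : ℤ) : 0 < chi d β m :=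
  Real.sqrt_pos.mpr (by positivity)

lemma chi_sq (d β : ℝ) (m : ℤ) : chi d β m ^ 2 = β ^ 2 + alpha d m ^ 2 :=
  Real.sq_sqrt (by positivity)

lemma sqrt_sq_div_four {z : ℝ} (hz : 0 < z) : Real.sqrt (z ^ 2 / 4) = z / 2 := by
  rw [show z ^ 2 / 4 = (z / 2) ^ 2 by ring, Real.sqrt_sq (by positivity)]

lemma fourier_coeff_two {d z P : ℝ} (hz : 0 < z) (hP : 0 ≤ P) :
    2 * Real.sqrt Real.pi / d * expInt (2 - 1 / 2) P (z ^ 2 / 4) =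
      4 * Real.pi / (d * z) * Real.exp (-(Real.sqrt P * z)) := by
  rw [show (2 - 1 / 2 : ℝ) = 3 / 2 by norm_num, expInt_three_halves hP (by positivity),
    sqrt_sq_div_four hz, show 2 * Real.sqrt P * (z / 2) = Real.sqrt P * z by ring]
  have := Real.mul_self_sqrt Real.pi_pos.le
  calc _ = 4 * (Real.sqrt Real.pi * Real.sqrt Real.pi) / (d * z) *
        Real.exp (-(Real.sqrt P * z)) := by field_simp; ring
    _ = _ := by rw [this]

lemma fourier_coeff_three {d z P : ℝ} (hz : 0 < z) (hP : 0 ≤ P) :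
    2 * Real.sqrt Real.pi / d * expInt (3 - 1 / 2) P (z ^ 2 / 4) =
      8 * Real.pi / (d * z ^ 2) * (1 / z + Real.sqrt P) * Real.exp (-(Real.sqrt P * z)) := by
  rw [show (3 - 1 / 2 : ℝ) = 5 / 2 by norm_num, expInt_five_halves hP (by positivity),
    sqrt_sq_div_four hz, show 2 * Real.sqrt P * (z / 2) = Real.sqrt P * z by ring]
  have := Real.mul_self_sqrt Real.pi_pos.le
  calc _ = 8 * (Real.sqrt Real.pi * Real.sqrt Real.pi) / (d * z ^ 2) * (1 / z + Real.sqrt P) *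
        Real.exp (-(Real.sqrt P * z)) := by field_simp; ring
    _ = _ := by rw [this]

lemma fourier_coeff_one {d z P : ℝ} (hz : 0 < z) (hP : 0 < P) :
    2 * Real.sqrt Real.pi / d * expInt (1 - 1 / 2) P (z ^ 2 / 4) =
      2 * Real.pi / (d * Real.sqrt P) * Real.exp (-(Real.sqrt P * z)) := by
  rw [show (1 - 1 / 2 : ℝ) = 1 / 2 by norm_num, expInt_half hP (by positivity),
    sqrt_sq_div_four hz, show 2 * Real.sqrt P * (z / 2) = Real.sqrt P * z by ring,
    Real.sqrt_div Real.pi_pos.le]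
  have := Real.mul_self_sqrt Real.pi_pos.le
  calc _ = 2 * (Real.sqrt Real.pi * Real.sqrt Real.pi) / (d * Real.sqrt P) *
        Real.exp (-(Real.sqrt P * z)) := by ring
    _ = _ := by rw [this]

lemma sameSum_expInt_two {p d z : ℝ} (hd : 0 < d) (hz : 0 < z) (hp : 0 ≤ p) (X : ℝ) :
    SameSum (fun m : ℤ => ((expInt 2 p (((X - m * d) ^ 2 + z ^ 2) / 4) : ℝ) : ℂ))
      (fun n : ℤ => ((4 * Real.pi / (d * z) *
        Real.exp (-(Real.sqrt (p + alpha d n ^ 2) * z)) : ℝ) : ℂ) *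
        Complex.exp (Complex.I * ((alpha d n * X : ℝ) : ℂ))) := by
  refine (sameSum_expInt (ν := 2) (p := p) (A := 1) hd hz (Or.inr ⟨hp, by norm_num⟩) zero_le_one
    (fun c hc => expInt_two_le hp (lt_of_lt_of_le (by positivity) hc)) X).congr
    (fun _ => rfl) fun n => ?_
  rw [fourier_coeff_two hz (by positivity)]

lemma sameSum_expInt_three {p d z : ℝ} (hd : 0 < d) (hz : 0 < z) (hp : 0 ≤ p) (X : ℝ) :
    SameSum (fun m : ℤ => ((expInt 3 p (((X - m * d) ^ 2 + z ^ 2) / 4) : ℝ) : ℂ))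
      (fun n : ℤ => ((8 * Real.pi / (d * z ^ 2) * (1 / z + Real.sqrt (p + alpha d n ^ 2)) *
        Real.exp (-(Real.sqrt (p + alpha d n ^ 2) * z)) : ℝ) : ℂ) *
        Complex.exp (Complex.I * ((alpha d n * X : ℝ) : ℂ))) := by
  refine (sameSum_expInt (ν := 3) (p := p) (A := 4 / z ^ 2) hd hz (Or.inr ⟨hp, by norm_num⟩)
    (by positivity) (fun c hc => ?_) X).congr (fun _ => rfl) fun n => ?_
  · have hc0 : 0 < c := lt_of_lt_of_le (by positivity) hc
    refine (expInt_three_le hp hc0).trans ?_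
    rw [div_div, div_le_div_iff₀ (by positivity) (by positivity)]
    nlinarith
  · rw [fourier_coeff_three hz (by positivity)]

lemma sameSum_expInt_one {p d z : ℝ} (hd : 0 < d) (hz : 0 < z) (hp : 0 < p) (X : ℝ) :
    SameSum (fun m : ℤ => ((expInt 1 p (((X - m * d) ^ 2 + z ^ 2) / 4) : ℝ) : ℂ))
      (fun n : ℤ => ((2 * Real.pi / (d * Real.sqrt (p + alpha d n ^ 2)) *
        Real.exp (-(Real.sqrt (p + alpha d n ^ 2) * z)) : ℝ) : ℂ) *
        Complex.exp (Complex.I * ((alpha d n * X : ℝ) : ℂ))) := by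
  refine (sameSum_expInt (ν := 1) (p := p) (A := p⁻¹) hd hz (Or.inl ⟨hp, by norm_num⟩)
    (by positivity) (fun c hc => ?_) X).congr (fun _ => rfl) fun n => ?_
  · have hc0 : 0 < c := lt_of_lt_of_le (by positivity) hc
    have := expInt_le_succ one_pos hp hc0
    rwa [Real.rpow_one, Real.Gamma_one, mul_one, mul_one_div] at this
  · rw [fourier_coeff_one hz (by positivity)]

lemma sqrt_zero_add_alpha_sq (d : ℝ) (n : ℤ) : Real.sqrt (0 + alpha d n ^ 2) = |alpha d n| := by
  rw [zero_add, Real.sqrt_sq_eq_abs]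

lemma sameSum_stokeslet_zero_zero {d β z : ℝ} (hd : 0 < d) (hβ : 0 < β) (hz : 0 < z) (X : ℝ) :
    SameSum (fun m : ℤ => ((modifiedStokeslet β (X - m * d, z) 0 0 : ℝ) : ℂ))
      (fun n : ℤ => rowMode d β z n 0 0 *
        Complex.exp (Complex.I * ((alpha d n * X : ℝ) : ℂ))) := by
  have hb : 0 ≤ β ^ 2 := by positivity
  have key := (((sameSum_expInt_two hd hz le_rfl X).const_mul
    ((1 / (8 * Real.pi * β ^ 2) : ℝ) : ℂ)).add ((sameSum_expInt_two hd hz hb X).const_mul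
    ((-(1 / (8 * Real.pi * β ^ 2)) : ℝ) : ℂ))).add
    (((sameSum_expInt_three hd hz le_rfl X).const_mul
    ((-(z ^ 2 / (16 * Real.pi * β ^ 2)) : ℝ) : ℂ)).add ((sameSum_expInt_three hd hz hb X).const_mul
    ((z ^ 2 / (16 * Real.pi * β ^ 2) : ℝ) : ℂ)))
  refine key.congr (fun m => ?_) fun n => ?_
  · rw [modifiedStokeslet_zero_zero hβ hz]
    simp only [radialD1, radialD2, ← Complex.ofReal_mul, ← Complex.ofReal_add]
    congr 1
    field_simp
    ring
  · simp only [← mul_assoc, ← add_mul]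
    congr 1
    simp only [sqrt_zero_add_alpha_sq, ← Complex.ofReal_mul, ← Complex.ofReal_add]
    change ((_ : ℝ) : ℂ) = _
    congr 1
    unfold chi
    field_simp
    ring

lemma sameSum_stokeslet_zero_one {d β z : ℝ} (hd : 0 < d) (hβ : 0 < β) (hz : 0 < z) (X : ℝ) :
    SameSum (fun m : ℤ => ((modifiedStokeslet β (X - m * d, z) 0 1 : ℝ) : ℂ))
      (fun n : ℤ => rowMode d β z n 0 1 *
        Complex.exp (Complex.I * ((alpha d n * X : ℝ) : ℂ))) := by
  have hb : 0 ≤ β ^ 2 := by positivity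
  have key := ((sameSum_mul_expInt_three hd hz le_rfl X).const_mul
    ((z / (16 * Real.pi * β ^ 2) : ℝ) : ℂ)).add ((sameSum_mul_expInt_three hd hz hb X).const_mul
    ((-(z / (16 * Real.pi * β ^ 2)) : ℝ) : ℂ))
  refine key.congr (fun m => ?_) fun n => ?_
  · rw [modifiedStokeslet_zero_one hβ hz]
    simp only [radialD2, ← Complex.ofReal_mul, ← Complex.ofReal_add]
    congr 1
    field_simp
    ring
  · simp only [← mul_assoc, ← add_mul]
    congr 1
    rw [fourier_coeff_two hz (by positivity), fourier_coeff_two hz (by positivity),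
      sqrt_zero_add_alpha_sq]
    change Complex.I * ((_ : ℝ) : ℂ) = _
    unfold chi
    have hd' : (d : ℂ) ≠ 0 := by exact_mod_cast hd.ne'
    have hz' : (z : ℂ) ≠ 0 := by exact_mod_cast hz.ne'
    have hβ' : (β : ℂ) ≠ 0 := by exact_mod_cast hβ.ne'
    have hπ : (Real.pi : ℂ) ≠ 0 := by exact_mod_cast Real.pi_ne_zero
    simp only [Complex.ofReal_mul, Complex.ofReal_div, Complex.ofReal_sub, Complex.ofReal_neg,
      Complex.ofReal_pow, Complex.ofReal_ofNat]
    field_simp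
    ring

lemma sameSum_stokeslet_one_one {d β z : ℝ} (hd : 0 < d) (hβ : 0 < β) (hz : 0 < z) (X : ℝ) :
    SameSum (fun m : ℤ => ((modifiedStokeslet β (X - m * d, z) 1 1 : ℝ) : ℂ))
      (fun n : ℤ => rowMode d β z n 1 1 *
        Complex.exp (Complex.I * ((alpha d n * X : ℝ) : ℂ))) := by
  have hb : 0 < β ^ 2 := by positivity
  have key := ((sameSum_expInt_one hd hz hb X).const_mul
    ((1 / (4 * Real.pi) : ℝ) : ℂ)).add ((sameSum_stokeslet_zero_zero hd hβ hz X).const_mul (-1))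
  refine key.congr (fun m => ?_) fun n => ?_
  · rw [modifiedStokeslet_one_one hβ hz]
    push_cast
    ring
  · simp only [← mul_assoc, ← add_mul]
    congr 1
    change ((_ : ℝ) : ℂ) = _ + -1 * ((_ : ℝ) : ℂ)
    rw [neg_one_mul, ← Complex.ofReal_mul, ← Complex.ofReal_neg, ← Complex.ofReal_add]
    congr 1
    have h1 := chi_pos d hβ n
    have h2 : alpha d n ^ 2 = chi d β n ^ 2 - β ^ 2 := by rw [chi_sq]; ring
    have h3 : Real.sqrt (β ^ 2 + alpha d n ^ 2) = chi d β n := rfl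
    rw [h3, h2]
    field_simp
    ring

/-- The Fourier series of a row of modified Stokeslets. -/
lemma sameSum_stokeslet {d β z : ℝ} (hd : 0 < d) (hβ : 0 < β) (hz : 0 < z) (X : ℝ)
    (a b : Fin 2) :
    SameSum (fun m : ℤ => ((modifiedStokeslet β (X - m * d, z) a b : ℝ) : ℂ))
      (fun n : ℤ => rowMode d β z n a b *
        Complex.exp (Complex.I * ((alpha d n * X : ℝ) : ℂ))) := by
  fin_cases a <;> fin_cases b
  · exact sameSum_stokeslet_zero_zero hd hβ hz X
  · exact sameSum_stokeslet_zero_one hd hβ hz X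
  · exact sameSum_stokeslet_zero_one hd hβ hz X
  · exact sameSum_stokeslet_one_one hd hβ hz X

/-! ### Nonzero modes: bounds uniform in β and the limit β → 0⁺ -/

/-- Used with base point α² and step β², where it cancels the factor 1/β² of the row coefficients.
-/
lemma abs_sub_le_of_deriv_bound {f f' : ℝ → ℝ} {x₀ B : ℝ}
    (hd : ∀ x, x₀ ≤ x → HasDerivAt f (f' x) x) (hB : ∀ x, x₀ ≤ x → |f' x| ≤ B) {h : ℝ}
    (hh : 0 ≤ h) : |f (h + x₀) - f x₀| ≤ B * h := by
  have := (convex_Ici x₀).norm_image_sub_le_of_norm_hasDerivWithin_le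
    (f := f) (f' := f') (C := B) (x := x₀) (y := h + x₀)
    (fun x hx => (hd x hx).hasDerivWithinAt) (fun x hx => hB x hx)
    (Set.mem_Ici.mpr le_rfl) (Set.mem_Ici.mpr (by linarith))
  rwa [add_sub_cancel_right, Real.norm_eq_abs, Real.norm_of_nonneg hh] at this

lemma tendsto_slope_sq {f : ℝ → ℝ} {f' x₀ : ℝ} (hd : HasDerivAt f f' x₀) :
    Tendsto (fun β : ℝ => (f (β ^ 2 + x₀) - f x₀) / β ^ 2) (𝓝[>] 0) (𝓝 f') := by
  have h := hasDerivAt_iff_tendsto_slope_zero.mp hd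
  have h2 : Tendsto (fun β : ℝ => β ^ 2) (𝓝[>] 0) (𝓝[≠] 0) := by
    refine tendsto_nhdsWithin_iff.mpr ⟨?_, ?_⟩
    · have : Tendsto (fun β : ℝ => β ^ 2) (𝓝 0) (𝓝 (0 ^ 2)) := (continuous_pow 2).tendsto 0
      rw [zero_pow two_ne_zero] at this
      exact this.mono_left nhdsWithin_le_nhds
    · filter_upwards [self_mem_nhdsWithin] with β hβ
      have hβ : 0 < β := hβ
      exact (by positivity : β ^ 2 ≠ 0)
  refine (h.comp h2).congr fun β => ?_
  simp only [Function.comp, smul_eq_mul]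
  rw [add_comm x₀]
  ring

lemma hasDerivAt_exp_neg_sqrt_mul (z : ℝ) {τ : ℝ} (hτ : 0 < τ) :
    HasDerivAt (fun τ => Real.exp (-(Real.sqrt τ * z)))
      (-(z / (2 * Real.sqrt τ)) * Real.exp (-(Real.sqrt τ * z))) τ := by
  refine (((Real.hasDerivAt_sqrt hτ.ne').mul_const z).neg.exp).congr_deriv ?_
  simp only [Pi.neg_apply]
  ring

lemma hasDerivAt_sqrt_mul_exp (z : ℝ) {τ : ℝ} (hτ : 0 < τ) :
    HasDerivAt (fun τ => Real.sqrt τ * Real.exp (-(Real.sqrt τ * z)))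
      (1 / 2 * (1 / Real.sqrt τ - z) * Real.exp (-(Real.sqrt τ * z))) τ := by
  refine ((Real.hasDerivAt_sqrt hτ.ne').mul (hasDerivAt_exp_neg_sqrt_mul z hτ)).congr_deriv ?_
  have := Real.sqrt_pos.mpr hτ
  field_simp
  ring

lemma hasDerivAt_exp_div_sqrt (z : ℝ) {τ : ℝ} (hτ : 0 < τ) :
    HasDerivAt (fun τ => Real.exp (-(Real.sqrt τ * z)) / Real.sqrt τ)
      (-(1 / 2) * (1 / Real.sqrt τ + z) / τ * Real.exp (-(Real.sqrt τ * z))) τ := by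
  have := Real.sqrt_pos.mpr hτ
  refine ((hasDerivAt_exp_neg_sqrt_mul z hτ).div (Real.hasDerivAt_sqrt hτ.ne')
    this.ne').congr_deriv ?_
  have h2 : τ = Real.sqrt τ ^ 2 := (Real.sq_sqrt hτ.le).symm
  generalize Real.sqrt τ = r at *
  subst h2
  field_simp
  ring

lemma decay_bound {a z τ : ℝ} (ha : 0 < a) (hz : 0 < z) (hτ : a ^ 2 ≤ τ) :
    (1 / Real.sqrt τ + z) * Real.exp (-(Real.sqrt τ * z)) ≤ (1 / a + z) * Real.exp (-(a * z)) := by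
  have : a ≤ Real.sqrt τ := Real.le_sqrt_of_sq_le hτ
  gcongr

lemma alpha_ne_zero {d : ℝ} (hd : 0 < d) {m : ℤ} (hm : m ≠ 0) : alpha d m ≠ 0 := by
  have : (m : ℝ) ≠ 0 := by exact_mod_cast hm
  have := Real.pi_ne_zero
  unfold alpha
  positivity

/-- The limit of `rowMode` as `β → 0⁺`, for `m ≠ 0`. -/
def limitMode (d z : ℝ) (m : ℤ) : Block :=
  (1 / (4 * (d : ℂ)) * ((Real.exp (-(|alpha d m| * z)) : ℝ) : ℂ)) •
    ((1 / ((|alpha d m| : ℝ) : ℂ)) • (1 : Block) - (z : ℂ) • signBlock m)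

lemma chi_eq (d β : ℝ) (m : ℤ) : chi d β m = Real.sqrt (β ^ 2 + |alpha d m| ^ 2) := by
  rw [sq_abs]; rfl

section
variable {d z : ℝ} {m : ℤ}

/-- The entries are difference quotients in τ, between α² and α² + β², of √τ exp(-√τ z), exp(-√τ z)
and exp(-√τ z)/√τ. The derivative bounds decrease in τ, so their values at τ = α² give a bound free
of β. -/
lemma norm_rowMode_le (hd : 0 < d) (hz : 0 < z) (hm : m ≠ 0) {β : ℝ} (hβ : 0 < β) (a b : Fin 2) :
    ‖rowMode d β z m a b‖ ≤
      1 / (4 * d) * ((1 / |alpha d m| + z) * Real.exp (-(|alpha d m| * z))) := by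
  have ha : 0 < |alpha d m| := abs_pos.mpr (alpha_ne_zero hd hm)
  have hχ := chi_eq d β m
  have hs : Real.sqrt (|alpha d m| ^ 2) = |alpha d m| := Real.sqrt_sq ha.le
  have hα2 : alpha d m ^ 2 = |alpha d m| ^ 2 := (sq_abs _).symm
  have hτ : ∀ τ, |alpha d m| ^ 2 ≤ τ → 0 < τ := fun τ h => lt_of_lt_of_le (by positivity) h
  have hβ2 : 0 ≤ β ^ 2 := by positivity
  have fin : ∀ v : ℝ, |v| ≤ 1 / 2 * ((1 / |alpha d m| + z) * Real.exp (-(|alpha d m| * z))) * β ^ 2 →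
      |v / (2 * d * β ^ 2)| ≤
        1 / (4 * d) * ((1 / |alpha d m| + z) * Real.exp (-(|alpha d m| * z))) := by
    intro v hv
    rw [abs_div, abs_of_pos (show 0 < 2 * d * β ^ 2 by positivity), div_le_iff₀ (by positivity)]
    refine hv.trans_eq ?_
    field_simp
    ring
  have b1 := abs_sub_le_of_deriv_bound (x₀ := |alpha d m| ^ 2)
    (B := 1 / 2 * ((1 / |alpha d m| + z) * Real.exp (-(|alpha d m| * z))))
    (fun τ h => hasDerivAt_sqrt_mul_exp z (hτ τ h)) (fun τ h => by
      have := Real.sqrt_pos.mpr (hτ τ h)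
      rw [abs_mul, abs_mul, abs_of_pos (Real.exp_pos _), abs_of_pos (one_half_pos), mul_assoc]
      refine mul_le_mul_of_nonneg_left (le_trans ?_ (decay_bound ha hz h)) one_half_pos.le
      gcongr
      refine (abs_sub _ _).trans_eq ?_
      rw [abs_of_pos hz, abs_of_pos (by positivity)]) hβ2
  have b2 := abs_sub_le_of_deriv_bound (x₀ := |alpha d m| ^ 2)
    (B := 1 / 2 * ((1 / |alpha d m| + z) * Real.exp (-(|alpha d m| * z))) / |alpha d m|)
    (fun τ h => hasDerivAt_exp_neg_sqrt_mul z (hτ τ h)) (fun τ h => by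
      have hp := Real.sqrt_pos.mpr (hτ τ h)
      have hle : |alpha d m| ≤ Real.sqrt τ := Real.le_sqrt_of_sq_le h
      rw [abs_mul, abs_neg, abs_of_pos (Real.exp_pos _), abs_of_pos (by positivity)]
      rw [show z / (2 * Real.sqrt τ) * Real.exp (-(Real.sqrt τ * z)) =
        1 / 2 * (z * Real.exp (-(Real.sqrt τ * z))) / Real.sqrt τ by field_simp]
      gcongr
      exact le_add_of_nonneg_left (by positivity)) hβ2
  have b3 := abs_sub_le_of_deriv_bound (x₀ := |alpha d m| ^ 2)
    (B := 1 / 2 * ((1 / |alpha d m| + z) * Real.exp (-(|alpha d m| * z))) / |alpha d m| ^ 2)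
    (fun τ h => hasDerivAt_exp_div_sqrt z (hτ τ h)) (fun τ h => by
      have hp := Real.sqrt_pos.mpr (hτ τ h)
      have h0 := hτ τ h
      rw [show -(1 / 2) * (1 / Real.sqrt τ + z) / τ * Real.exp (-(Real.sqrt τ * z)) =
        -(1 / 2 * ((1 / Real.sqrt τ + z) * Real.exp (-(Real.sqrt τ * z))) / τ) by ring,
        abs_neg, abs_of_pos (by positivity)]
      have := decay_bound ha hz h
      gcongr) hβ2
  simp only [hs, ← hχ] at b1 b2 b3
  have b2' : ‖rowMode d β z m 0 1‖ ≤
      1 / (4 * d) * ((1 / |alpha d m| + z) * Real.exp (-(|alpha d m| * z))) := by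
    change ‖Complex.I * ((_ : ℝ) : ℂ)‖ ≤ _
    rw [norm_mul, Complex.norm_I, one_mul, Complex.norm_real]
    refine fin _ ?_
    rw [abs_mul]
    refine (mul_le_mul_of_nonneg_left b2 ha.le).trans_eq ?_
    field_simp
  fin_cases a <;> fin_cases b
  · change ‖((_ : ℝ) : ℂ)‖ ≤ _
    rw [Complex.norm_real]
    exact fin _ b1
  · exact b2'
  · exact b2'
  · change ‖((_ : ℝ) : ℂ)‖ ≤ _
    rw [Complex.norm_real]
    refine fin _ ?_
    rw [show |alpha d m| * Real.exp (-(|alpha d m| * z)) -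
        alpha d m ^ 2 / chi d β m * Real.exp (-(chi d β m * z)) =
        -(|alpha d m| ^ 2 * (Real.exp (-(chi d β m * z)) / chi d β m -
          Real.exp (-(|alpha d m| * z)) / |alpha d m|)) by rw [hα2]; field_simp; ring,
      abs_neg, abs_mul, abs_of_pos (show 0 < |alpha d m| ^ 2 by positivity)]
    refine (mul_le_mul_of_nonneg_left b3 (by positivity)).trans_eq ?_
    field_simp

/-- The same difference quotients converge to the derivatives at τ = α², and sign(m) appears as
α/|α|. -/
lemma tendsto_rowMode (hd : 0 < d) (hm : m ≠ 0) (a b : Fin 2) :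
    Tendsto (fun β : ℝ => rowMode d β z m a b) (𝓝[>] 0) (𝓝 (limitMode d z m a b)) := by
  have ha : 0 < |alpha d m| := abs_pos.mpr (alpha_ne_zero hd hm)
  have hs : Real.sqrt (|alpha d m| ^ 2) = |alpha d m| := Real.sqrt_sq ha.le
  have hα2 : alpha d m ^ 2 = |alpha d m| ^ 2 := (sq_abs _).symm
  have ha2 : 0 < |alpha d m| ^ 2 := by positivity
  have t1 := (tendsto_slope_sq (hasDerivAt_sqrt_mul_exp z ha2)).div_const (2 * d)
  have t2 := ((tendsto_slope_sq (hasDerivAt_exp_neg_sqrt_mul z ha2)).div_const (2 * d)).const_mul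
    (alpha d m)
  have t3 := ((tendsto_slope_sq (hasDerivAt_exp_div_sqrt z ha2)).div_const (2 * d)).const_mul
    (-|alpha d m| ^ 2)
  simp only [hs, ← chi_eq] at t1 t2 t3
  have hd' : (d : ℂ) ≠ 0 := by exact_mod_cast hd.ne'
  have ha' : ((|alpha d m| : ℝ) : ℂ) ≠ 0 := by exact_mod_cast ha.ne'
  have ha'' : (alpha d m : ℂ) ≠ 0 := by exact_mod_cast alpha_ne_zero hd hm
  have hsign : (m.sign : ℂ) = ((alpha d m / |alpha d m| : ℝ) : ℂ) := by
    have hm' : |(m : ℝ)| ≠ 0 := abs_ne_zero.mpr (by exact_mod_cast hm)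
    have h1 : alpha d m / |alpha d m| = (m : ℝ) / |(m : ℝ)| := by
      rw [abs_alpha hd]; unfold alpha
      have := Real.pi_ne_zero
      field_simp
    have h2 : ((m.sign : ℤ) : ℝ) = (m : ℝ) / |(m : ℝ)| := by
      rw [eq_div_iff hm']
      exact_mod_cast Int.sign_mul_abs m
    rw [h1, ← h2]; simp
  have t2' : Tendsto (fun β : ℝ => rowMode d β z m 0 1) (𝓝[>] 0) (𝓝 (limitMode d z m 0 1)) := by
    have h := (Complex.continuous_ofReal.tendsto _ |>.comp t2).const_mul Complex.I
    convert h using 2 with β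
    · change Complex.I * ((_ : ℝ) : ℂ) = _
      simp only [Function.comp]
      congr 2
      ring
    · simp only [limitMode, signBlock, hsign, Matrix.smul_apply, Matrix.sub_apply, smul_eq_mul]
      simp
      field_simp
      ring
  fin_cases a <;> fin_cases b
  · have h := (Complex.continuous_ofReal.tendsto _ |>.comp t1)
    convert h using 2 with β
    · change ((_ : ℝ) : ℂ) = _
      simp only [Function.comp]
      congr 1
      ring
    · simp only [limitMode, signBlock, Matrix.smul_apply, Matrix.sub_apply, smul_eq_mul]
      simp
      field_simp
      ring
  · exact t2'
  · have e : limitMode d z m 1 0 = limitMode d z m 0 1 := by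
      simp [limitMode, signBlock]
    simp only [Fin.mk_one, Fin.zero_eta]
    rw [e]
    exact t2'
  · have h := (Complex.continuous_ofReal.tendsto _ |>.comp t3)
    convert h using 2 with β
    · change ((_ : ℝ) : ℂ) = _
      simp only [Function.comp]
      congr 1
      rw [hα2]
      have := ha.ne'
      field_simp
      ring
    · simp only [limitMode, signBlock, Matrix.smul_apply, Matrix.sub_apply, smul_eq_mul]
      simp
      field_simp
      ring

end

/-! ### Summation over the rows -/

/-- Horizontal offset of the target from the row `n = -(k + 2)` of images of the source. -/
def rowX (ξ : ℝ) (t s : ℝ × ℝ) (k : ℕ) : ℝ := t.1 - s.1 + (k + 2) * ξ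

/-- Vertical offset of the target from the row `n = -(k + 2)` of images of the source. -/
def rowZ (η : ℝ) (t s : ℝ × ℝ) (k : ℕ) : ℝ := t.2 - s.2 + (k + 2) * η

lemma sub_add_latticeVec (d ξ η : ℝ) (t s : ℝ × ℝ) (m : ℤ) (k : ℕ) :
    t - (s + latticeVec d ξ η m (-((k : ℤ) + 2))) = (rowX ξ t s k - m * d, rowZ η t s k) := by
  unfold latticeVec rowX rowZ
  ext <;> push_cast <;> simp <;> ring

lemma abs_snd_le_of_mem_unitCell {d ξ η : ℝ} (hη : 0 < η) {t : ℝ × ℝ} (ht : t ∈ unitCell d ξ η) :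
    |t.2| ≤ η / 2 := by
  obtain ⟨a, -, b, ⟨hb1, hb2⟩, rfl⟩ := ht
  rw [abs_le]
  constructor <;> simp only <;> nlinarith

section
variable {d ξ η : ℝ} {t s : ℝ × ℝ}

/-- Both heights lie in [-η/2, η/2], so y - y' costs at most one η. Omitting the rows n = 0 and n =
-1 thus keeps target and images at vertical distance at least η. -/
lemma rowZ_ge (hη : 0 < η) (ht : t ∈ unitCell d ξ η) (hs : s ∈ unitCell d ξ η) (k : ℕ) :
    (k + 1) * η ≤ rowZ η t s k := by
  have h1 := abs_le.mp (abs_snd_le_of_mem_unitCell hη ht)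
  have h2 := abs_le.mp (abs_snd_le_of_mem_unitCell hη hs)
  unfold rowZ
  linarith [h1.1, h2.2]

lemma rowZ_le (hη : 0 < η) (ht : t ∈ unitCell d ξ η) (hs : s ∈ unitCell d ξ η) (k : ℕ) :
    rowZ η t s k ≤ (k + 3) * η := by
  have h1 := abs_le.mp (abs_snd_le_of_mem_unitCell hη ht)
  have h2 := abs_le.mp (abs_snd_le_of_mem_unitCell hη hs)
  unfold rowZ
  linarith [h1.2, h2.1]

lemma rowZ_pos (hη : 0 < η) (ht : t ∈ unitCell d ξ η) (hs : s ∈ unitCell d ξ η) (k : ℕ) :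
    0 < rowZ η t s k :=
  lt_of_lt_of_le (by positivity) (rowZ_ge hη ht hs k)

/-- The `m`-th Fourier mode, `m ≠ 0`, of the row `n = -(k + 2)`, indexed by `(k, m)`. -/
def southTerm (d ξ η β : ℝ) (t s : ℝ × ℝ) (a b : Fin 2) (q : ℕ × ℤ) : ℂ :=
  if q.2 = 0 then 0 else rowMode d β (rowZ η t s q.1) q.2 a b *
    Complex.exp (Complex.I * ((alpha d q.2 * rowX ξ t s q.1 : ℝ) : ℂ))

/-- The limit of `southTerm` as `β → 0⁺`. -/
def southTermLimit (d ξ η : ℝ) (t s : ℝ × ℝ) (a b : Fin 2) (q : ℕ × ℤ) : ℂ :=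
  if q.2 = 0 then 0 else limitMode d (rowZ η t s q.1) q.2 a b *
    Complex.exp (Complex.I * ((alpha d q.2 * rowX ξ t s q.1 : ℝ) : ℂ))

/-- A summable bound for `southTerm`, uniform in `β`. -/
def southMajorant (d η : ℝ) (q : ℕ × ℤ) : ℝ :=
  (1 / (4 * d) * (d / (2 * Real.pi) + η) *
    (((q.1 : ℝ) + 3) * Real.exp (-(2 * Real.pi * η / d)) ^ q.1)) *
      Real.exp (-(2 * Real.pi * η / d * |(q.2 : ℝ)|))

lemma southMajorant_nonneg (hd : 0 < d) (hη : 0 < η) (q : ℕ × ℤ) : 0 ≤ southMajorant d η q := by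
  unfold southMajorant
  positivity

lemma summable_southMajorant (hd : 0 < d) (hη : 0 < η) : Summable (southMajorant d η) := by
  have hκ : 0 < 2 * Real.pi * η / d := by positivity
  have hr : ‖Real.exp (-(2 * Real.pi * η / d))‖ < 1 := by
    rw [Real.norm_of_nonneg (Real.exp_pos _).le, Real.exp_lt_one_iff]; linarith
  have h1 : Summable fun k : ℕ => 1 / (4 * d) * (d / (2 * Real.pi) + η) *
      (((k : ℝ) + 3) * Real.exp (-(2 * Real.pi * η / d)) ^ k) := by
    refine Summable.mul_left _ ?_
    have e1 := summable_pow_mul_geometric_of_norm_lt_one 1 hr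
    have e2 := (summable_geometric_of_norm_lt_one hr).mul_left 3
    refine (e1.add e2).congr fun k => ?_
    rw [pow_one]; ring
  have h2 : Summable fun m : ℤ => Real.exp (-(2 * Real.pi * η / d * |(m : ℝ)|)) := by
    simpa using summable_int_pow_mul_exp hκ 0
  have n1 : ∀ k : ℕ, 0 ≤ 1 / (4 * d) * (d / (2 * Real.pi) + η) *
      (((k : ℝ) + 3) * Real.exp (-(2 * Real.pi * η / d)) ^ k) := fun k => by positivity
  have h3 := Summable.mul_of_nonneg h1 h2 n1 (fun m => (Real.exp_pos _).le)
  exact h3.congr fun q => by rw [southMajorant]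

lemma one_le_abs_cast {m : ℤ} (hm : m ≠ 0) : 1 ≤ |(m : ℝ)| := by
  exact_mod_cast Int.one_le_abs hm

/-- For |m| ≥ 1 one has |m|(k + 1) ≥ |m| + k, so the exponential decay splits into a factor
geometric in k and one geometric in |m|. -/
lemma norm_southTerm_le (hd : 0 < d) (hη : 0 < η) (ht : t ∈ unitCell d ξ η)
    (hs : s ∈ unitCell d ξ η) {β : ℝ} (hβ : 0 < β) (a b : Fin 2) (q : ℕ × ℤ) :
    ‖southTerm d ξ η β t s a b q‖ ≤ southMajorant d η q := by
  obtain ⟨k, m⟩ := q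
  unfold southTerm
  split_ifs with hm
  · rw [norm_zero]; exact southMajorant_nonneg hd hη _
  simp only at hm ⊢
  rw [norm_mul, mul_comm Complex.I, Complex.norm_exp_ofReal_mul_I, mul_one]
  refine (norm_rowMode_le hd (rowZ_pos hη ht hs k) hm hβ a b).trans ?_
  unfold southMajorant
  simp only
  have hm1 := one_le_abs_cast hm
  have h1 : 1 / |alpha d m| ≤ d / (2 * Real.pi) := by
    rw [abs_alpha hd, div_le_div_iff₀ (by positivity) (by positivity)]
    rw [show d * (2 * Real.pi / d * |(m : ℝ)|) = 2 * Real.pi * |(m : ℝ)| by field_simp]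
    nlinarith [Real.pi_pos]
  have h2 : Real.exp (-(|alpha d m| * rowZ η t s k)) ≤
      Real.exp (-(2 * Real.pi * η / d)) ^ k * Real.exp (-(2 * Real.pi * η / d * |(m : ℝ)|)) := by
    rw [← Real.exp_nat_mul, ← Real.exp_add, Real.exp_le_exp, abs_alpha hd]
    have hz := rowZ_ge hη ht hs k
    have h3 : 2 * Real.pi / d * |(m : ℝ)| * ((k + 1) * η) ≤
        2 * Real.pi / d * |(m : ℝ)| * rowZ η t s k := by gcongr
    have h4 : 2 * Real.pi / d * |(m : ℝ)| * ((k + 1) * η) =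
        2 * Real.pi * η / d * (|(m : ℝ)| * (k + 1)) := by ring
    have h5 : 2 * Real.pi * η / d * (|(m : ℝ)| + k) ≤
        2 * Real.pi * η / d * (|(m : ℝ)| * (k + 1)) := by
      gcongr
      nlinarith [(Nat.cast_nonneg k : (0 : ℝ) ≤ k)]
    linarith
  have h6 : 1 / |alpha d m| + rowZ η t s k ≤ (d / (2 * Real.pi) + η) * (k + 3) := by
    have hz := rowZ_le hη ht hs k
    have : 0 ≤ d / (2 * Real.pi) := by positivity
    nlinarith [mul_nonneg this (Nat.cast_nonneg k : (0 : ℝ) ≤ k)]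
  have hzp := rowZ_pos hη ht hs k
  have hap : 0 ≤ 1 / |alpha d m| := by positivity
  calc _ ≤ 1 / (4 * d) * (((d / (2 * Real.pi) + η) * (k + 3)) *
        (Real.exp (-(2 * Real.pi * η / d)) ^ k * Real.exp (-(2 * Real.pi * η / d * |(m : ℝ)|)))) := by
        gcongr
    _ = _ := by ring

lemma summable_southTerm (hd : 0 < d) (hη : 0 < η) (ht : t ∈ unitCell d ξ η)
    (hs : s ∈ unitCell d ξ η) {β : ℝ} (hβ : 0 < β) (a b : Fin 2) :
    Summable (southTerm d ξ η β t s a b) :=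
  Summable.of_norm_bounded (summable_southMajorant hd hη)
    (norm_southTerm_le hd hη ht hs hβ a b)

/-- The block of the zero mode. -/
def zeroBlock : Matrix (Fin 2) (Fin 2) ℝ := !![1, 0; 0, 0]

/-- The only singular mode: it grows like 1/β, acts in the horizontal component alone and depends
only on the vertical offset. -/
lemma rowMode_zero (d z : ℝ) {β : ℝ} (hβ : 0 < β) (a b : Fin 2) :
    rowMode d β z 0 a b = ((Real.exp (-(β * z)) / (2 * d * β) * zeroBlock a b : ℝ) : ℂ) := by
  have ha : alpha d 0 = 0 := by simp [alpha]
  have hc : chi d β 0 = β := by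
    rw [chi, ha]; simp [Real.sqrt_sq hβ.le]
  have : (β : ℂ) ≠ 0 := by exact_mod_cast hβ.ne'
  fin_cases a <;> fin_cases b <;> simp [rowMode, zeroBlock, ha, hc]
  field_simp

lemma matrix_hasSum_iff {ι : Type*} {f : ι → Matrix (Fin 2) (Fin 2) ℝ}
    {M : Matrix (Fin 2) (Fin 2) ℝ} :
    HasSum f M ↔ ∀ a b, HasSum (fun i => f i a b) (M a b) := by
  rw [← forall_congr' fun a => Pi.hasSum (f := fun i => f i a) (g := M a)]
  exact Pi.hasSum

lemma matrix_summable_iff {ι : Type*} {f : ι → Matrix (Fin 2) (Fin 2) ℝ} :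
    Summable f ↔ ∀ a b, Summable fun i => f i a b := by
  rw [← forall_congr' fun a => Pi.summable (f := fun i => f i a)]
  exact Pi.summable

lemma sameSum_southRow (hd : 0 < d) (hη : 0 < η) (ht : t ∈ unitCell d ξ η)
    (hs : s ∈ unitCell d ξ η) {β : ℝ} (hβ : 0 < β) (k : ℕ) (a b : Fin 2) :
    SameSum (fun m : ℤ => ((modifiedStokeslet β
        (t - (s + latticeVec d ξ η m (-((k : ℤ) + 2)))) a b : ℝ) : ℂ))
      (fun m : ℤ => rowMode d β (rowZ η t s k) m a b *
        Complex.exp (Complex.I * ((alpha d m * rowX ξ t s k : ℝ) : ℂ))) := by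
  simp_rw [sub_add_latticeVec]
  exact sameSum_stokeslet hd hβ (rowZ_pos hη ht hs k) _ a b

lemma summable_stokeslet_row (hd : 0 < d) (hη : 0 < η) (ht : t ∈ unitCell d ξ η)
    (hs : s ∈ unitCell d ξ η) {β : ℝ} (hβ : 0 < β) (k : ℕ) :
    Summable fun m : ℤ =>
      modifiedStokeslet β (t - (s + latticeVec d ξ η m (-((k : ℤ) + 2)))) := by
  refine matrix_summable_iff.mpr fun a b => ?_
  obtain ⟨S, h, -⟩ := sameSum_southRow hd hη ht hs hβ k a b
  exact Complex.summable_ofReal.mp h.summable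

/-- The zero mode is split off because the remaining modes have a majorant independent of β and it
does not. -/
lemma hasSum_southRow_modes (hd : 0 < d) (hη : 0 < η) (ht : t ∈ unitCell d ξ η)
    (hs : s ∈ unitCell d ξ η) {β : ℝ} (hβ : 0 < β) (k : ℕ) (a b : Fin 2) :
    HasSum (fun m : ℤ => southTerm d ξ η β t s a b (k, m))
      ((modifiedSouthRow d ξ η β t s k a b -
        Real.exp (-(β * rowZ η t s k)) / (2 * d * β) * zeroBlock a b : ℝ) : ℂ) := by
  obtain ⟨S, h1, h2⟩ := sameSum_southRow hd hη ht hs hβ k a b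
  have hrow : S = ((modifiedSouthRow d ξ η β t s k a b : ℝ) : ℂ) := by
    have := matrix_hasSum_iff.mp (summable_stokeslet_row hd hη ht hs hβ k).hasSum a b
    exact h1.unique (Complex.hasSum_ofReal.mpr this)
  rw [hrow] at h2
  have h3 := h2.sub (hasSum_ite_eq (0 : ℤ) (rowMode d β (rowZ η t s k) 0 a b))
  rw [rowMode_zero d _ hβ, ← Complex.ofReal_sub] at h3
  refine h3.congr_fun fun m => ?_
  unfold southTerm
  by_cases hm : m = 0
  · subst hm
    have ha : alpha d 0 = 0 := by simp [alpha]
    simp [ha, ← rowMode_zero d _ hβ]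
  · simp [hm]

/-- The part of the modified south kernel carried by the zero mode. -/
def zeroMode (d η β : ℝ) (t s : ℝ × ℝ) : ℝ :=
  Real.exp (-(β * rowZ η t s 0)) / (2 * d * β * (1 - Real.exp (-(β * η))))

lemma hasSum_zeroMode (hη : 0 < η) {β : ℝ} (hβ : 0 < β) (t s : ℝ × ℝ) :
    HasSum (fun k : ℕ => Real.exp (-(β * rowZ η t s k)) / (2 * d * β)) (zeroMode d η β t s) := by
  have hr : Real.exp (-(β * η)) < 1 := by
    rw [Real.exp_lt_one_iff]; nlinarith [mul_pos hβ hη]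
  have h := (hasSum_geometric_of_lt_one (Real.exp_pos (-(β * η))).le hr).mul_left
    (Real.exp (-(β * rowZ η t s 0)) / (2 * d * β))
  have e : Real.exp (-(β * rowZ η t s 0)) / (2 * d * β) * (1 - Real.exp (-(β * η)))⁻¹ =
      zeroMode d η β t s := by
    unfold zeroMode
    rw [← div_eq_mul_inv, div_div]
  rw [e] at h
  refine h.congr_fun fun k => ?_
  rw [← Real.exp_nat_mul, div_mul_eq_mul_div, ← Real.exp_add]
  congr 2
  unfold rowZ
  push_cast
  ring

/-- Joint summability over rows and nonzero modes allows each row to be summed first; the zero modes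
add up as a geometric series. This also yields convergence of the outer series. -/
lemma hasSum_southRow (hd : 0 < d) (hη : 0 < η) (ht : t ∈ unitCell d ξ η)
    (hs : s ∈ unitCell d ξ η) {β : ℝ} (hβ : 0 < β) (a b : Fin 2) :
    HasSum (fun k : ℕ => ((modifiedSouthRow d ξ η β t s k a b : ℝ) : ℂ))
      (((zeroMode d η β t s * zeroBlock a b : ℝ) : ℂ) + ∑' q, southTerm d ξ η β t s a b q) := by
  have h1 := (summable_southTerm hd hη ht hs hβ a b).hasSum.prod_fiberwise
    (hasSum_southRow_modes hd hη ht hs hβ · a b)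
  have h2 := Complex.hasSum_ofReal.mpr
    ((hasSum_zeroMode (d := d) hη hβ t s).mul_right (zeroBlock a b))
  refine (h2.add h1).congr_fun fun k => ?_
  push_cast
  ring

lemma summable_southRow (hd : 0 < d) (hη : 0 < η) (ht : t ∈ unitCell d ξ η)
    (hs : s ∈ unitCell d ξ η) {β : ℝ} (hβ : 0 < β) :
    Summable fun k : ℕ => modifiedSouthRow d ξ η β t s k :=
  matrix_summable_iff.mpr fun a b =>
    Complex.summable_ofReal.mp (hasSum_southRow hd hη ht hs hβ a b).summable

lemma modifiedSouthKernel_eq (hd : 0 < d) (hη : 0 < η) (ht : t ∈ unitCell d ξ η)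
    (hs : s ∈ unitCell d ξ η) {β : ℝ} (hβ : 0 < β) (a b : Fin 2) :
    ((modifiedSouthKernel d ξ η β t s a b : ℝ) : ℂ) =
      ((zeroMode d η β t s * zeroBlock a b : ℝ) : ℂ) + ∑' q, southTerm d ξ η β t s a b q := by
  have h := matrix_hasSum_iff.mp (summable_southRow hd hη ht hs hβ).hasSum a b
  exact (Complex.hasSum_ofReal.mpr h).unique (hasSum_southRow hd hη ht hs hβ a b)

lemma tendsto_southTerm (hd : 0 < d) (a b : Fin 2) (q : ℕ × ℤ) :
    Tendsto (fun β => southTerm d ξ η β t s a b q) (𝓝[>] 0)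
      (𝓝 (southTermLimit d ξ η t s a b q)) := by
  unfold southTerm southTermLimit
  split_ifs with hm
  · exact tendsto_const_nhds
  · exact (tendsto_rowMode hd hm a b).mul_const _

lemma norm_southTermLimit_le (hd : 0 < d) (hη : 0 < η) (ht : t ∈ unitCell d ξ η)
    (hs : s ∈ unitCell d ξ η) (a b : Fin 2) (q : ℕ × ℤ) :
    ‖southTermLimit d ξ η t s a b q‖ ≤ southMajorant d η q := by
  refine le_of_tendsto (tendsto_southTerm hd a b q).norm ?_
  filter_upwards [self_mem_nhdsWithin] with β hβ
  exact norm_southTerm_le hd hη ht hs hβ a b q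

lemma summable_southTermLimit (hd : 0 < d) (hη : 0 < η) (ht : t ∈ unitCell d ξ η)
    (hs : s ∈ unitCell d ξ η) (a b : Fin 2) : Summable (southTermLimit d ξ η t s a b) :=
  Summable.of_norm_bounded (summable_southMajorant hd hη) (norm_southTermLimit_le hd hη ht hs a b)

lemma tendsto_tsum_southTerm (hd : 0 < d) (hη : 0 < η) (ht : t ∈ unitCell d ξ η)
    (hs : s ∈ unitCell d ξ η) (a b : Fin 2) :
    Tendsto (fun β => ∑' q, southTerm d ξ η β t s a b q) (𝓝[>] 0)
      (𝓝 (∑' q, southTermLimit d ξ η t s a b q)) := by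
  refine tendsto_tsum_of_dominated_convergence (summable_southMajorant hd hη)
    (tendsto_southTerm hd a b) ?_
  filter_upwards [self_mem_nhdsWithin] with β hβ q
  exact norm_southTerm_le hd hη ht hs hβ a b q

end

/-! ### The zero mode, charge neutrality and the limit kernel -/

section
variable {d ξ η : ℝ} {t s : ℝ × ℝ}

/-- The south kernel of the Stokeslet with charge neutrality. -/
def southKernel (d ξ η : ℝ) (t s : ℝ × ℝ) : Matrix (Fin 2) (Fin 2) ℝ :=
  Matrix.of fun a b => -(t.2 * s.2 / (2 * d * η)) * zeroBlock a b +
    (∑' q, southTermLimit d ξ η t s a b q).re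

lemma tsum_southTerm_im (hd : 0 < d) (hη : 0 < η) (ht : t ∈ unitCell d ξ η)
    (hs : s ∈ unitCell d ξ η) {β : ℝ} (hβ : 0 < β) (a b : Fin 2) :
    (∑' q, southTerm d ξ η β t s a b q).im = 0 := by
  have := congrArg Complex.im (modifiedSouthKernel_eq hd hη ht hs hβ a b)
  simpa only [Complex.add_im, Complex.ofReal_im, zero_add] using this.symm

/-- The real part in the definition loses nothing: for β > 0 the mode sum is real because the
lattice sum is, and vanishing of the imaginary part passes to the limit. -/
lemma ofReal_southKernel (hd : 0 < d) (hη : 0 < η) (ht : t ∈ unitCell d ξ η)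
    (hs : s ∈ unitCell d ξ η) (a b : Fin 2) :
    ((southKernel d ξ η t s a b : ℝ) : ℂ) =
      ((-(t.2 * s.2 / (2 * d * η)) * zeroBlock a b : ℝ) : ℂ) +
        ∑' q, southTermLimit d ξ η t s a b q := by
  have h := (Complex.continuous_im.tendsto _).comp (tendsto_tsum_southTerm hd hη ht hs a b)
  have h0 : (∑' q, southTermLimit d ξ η t s a b q).im = 0 := by
    refine tendsto_nhds_unique h (tendsto_const_nhds.congr' ?_)
    filter_upwards [self_mem_nhdsWithin] with β hβ
    exact (tsum_southTerm_im hd hη ht hs hβ a b).symm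
  apply Complex.ext
  · simp [southKernel]
  · simp only [Complex.add_im, Complex.ofReal_im, h0, add_zero]

/-- The common factor `e^{-2βη} / (2 d β (1 - e^{-βη}))` of the zero mode. -/
def zeroFactor (d η β : ℝ) : ℝ :=
  Real.exp (-(2 * β * η)) / (2 * d * β * (1 - Real.exp (-(β * η))))

/-- The part of the zero mode that depends on both target and source. -/
def zeroCoupling (d η β : ℝ) (t s : ℝ × ℝ) : ℝ :=
  zeroFactor d η β * ((Real.exp (-t.2 * β) - 1) * (Real.exp (s.2 * β) - 1))

/-- With A = exp(-β y) and B = exp(β y'), this is AB = (A - 1) + B + (A - 1)(B - 1): a target-only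
part, a source-only part and a coupling. -/
lemma zeroMode_eq (d η β : ℝ) (t s : ℝ × ℝ) :
    zeroMode d η β t s = zeroFactor d η β * (Real.exp (-t.2 * β) - 1) +
      zeroFactor d η β * Real.exp (s.2 * β) + zeroCoupling d η β t s := by
  have : Real.exp (-(β * rowZ η t s 0)) =
      Real.exp (-(2 * β * η)) * Real.exp (-t.2 * β) * Real.exp (s.2 * β) := by
    rw [← Real.exp_add, ← Real.exp_add]
    congr 1
    unfold rowZ
    push_cast
    ring
  unfold zeroMode zeroCoupling zeroFactor
  rw [this]
  ring

lemma tendsto_exp_mul_sub_one_div (c : ℝ) :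
    Tendsto (fun β : ℝ => (Real.exp (c * β) - 1) / β) (𝓝[>] 0) (𝓝 c) := by
  have h : HasDerivAt (fun β : ℝ => Real.exp (c * β)) c 0 := by
    refine ((hasDerivAt_id (0 : ℝ)).const_mul c).exp.congr_deriv ?_
    simp
  have h2 := (hasDerivAt_iff_tendsto_slope_zero.mp h).mono_left
    (nhdsWithin_mono 0 (fun x (hx : 0 < x) => hx.ne'))
  refine h2.congr fun β => ?_
  simp only [zero_add, mul_zero, Real.exp_zero, smul_eq_mul]
  ring

/-- The common factor behaves like 1/(2dηβ²), and the two differences like -β y and β y'. -/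
lemma tendsto_zeroCoupling (hd : 0 < d) (hη : 0 < η) (t s : ℝ × ℝ) :
    Tendsto (fun β => zeroCoupling d η β t s) (𝓝[>] 0) (𝓝 (-(t.2 * s.2 / (2 * d * η)))) := by
  have h1 := tendsto_exp_mul_sub_one_div (-t.2)
  have h2 := tendsto_exp_mul_sub_one_div s.2
  have h3 := (tendsto_exp_mul_sub_one_div (-η)).inv₀ (neg_ne_zero.mpr hη.ne')
  have h4 : Tendsto (fun β : ℝ => Real.exp (-(2 * β * η))) (𝓝[>] 0) (𝓝 1) := by
    have : Tendsto (fun β : ℝ => Real.exp (-(2 * β * η))) (𝓝 0) (𝓝 (Real.exp (-(2 * 0 * η)))) := by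
      apply Continuous.tendsto
      fun_prop
    rw [mul_zero, zero_mul, neg_zero, Real.exp_zero] at this
    exact this.mono_left nhdsWithin_le_nhds
  have h := ((h1.mul h2).mul (h3.mul h4)).mul_const (-(1 / (2 * d)))
  have e : -t.2 * s.2 * ((-η)⁻¹ * 1) * (-(1 / (2 * d))) = -(t.2 * s.2 / (2 * d * η)) := by
    field_simp
  rw [e] at h
  refine h.congr' ?_
  filter_upwards [self_mem_nhdsWithin] with β hβ
  have hβ : 0 < β := hβ
  have hne : Real.exp (-η * β) < 1 := by
    rw [Real.exp_lt_one_iff]; nlinarith [mul_pos hβ hη]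
  have hne1 : 1 - Real.exp (-η * β) ≠ 0 := by linarith
  have hne2 : Real.exp (-η * β) - 1 ≠ 0 := by linarith
  unfold zeroCoupling zeroFactor
  rw [show -(β * η) = -η * β by ring]
  have e2 : 1 - Real.exp (-η * β) = -(Real.exp (-η * β) - 1) := by ring
  rw [e2]
  field_simp

/-- The modified south kernel without the parts of the zero mode that depend on the target only or
on the source only. -/
def reducedKernel (d ξ η β : ℝ) (t s : ℝ × ℝ) : Matrix (Fin 2) (Fin 2) ℝ :=
  Matrix.of fun a b => zeroCoupling d η β t s * zeroBlock a b +
    (∑' q, southTerm d ξ η β t s a b q).re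

lemma modifiedSouthKernel_eq_reducedKernel (hd : 0 < d) (hη : 0 < η) (ht : t ∈ unitCell d ξ η)
    (hs : s ∈ unitCell d ξ η) {β : ℝ} (hβ : 0 < β) :
    modifiedSouthKernel d ξ η β t s =
      (zeroFactor d η β * (Real.exp (-t.2 * β) - 1)) • zeroBlock +
        (zeroFactor d η β * Real.exp (s.2 * β)) • zeroBlock + reducedKernel d ξ η β t s := by
  ext a b
  have h := congrArg Complex.re (modifiedSouthKernel_eq hd hη ht hs hβ a b)
  rw [Complex.add_re, Complex.ofReal_re, Complex.ofReal_re, zeroMode_eq] at h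
  rw [h]
  simp only [reducedKernel, Matrix.add_apply, Matrix.smul_apply, Matrix.of_apply, smul_eq_mul]
  ring

lemma tendsto_reducedKernel (hd : 0 < d) (hη : 0 < η) (ht : t ∈ unitCell d ξ η)
    (hs : s ∈ unitCell d ξ η) :
    Tendsto (fun β => reducedKernel d ξ η β t s) (𝓝[>] 0) (𝓝 (southKernel d ξ η t s)) := by
  refine tendsto_pi_nhds.mpr fun a => tendsto_pi_nhds.mpr fun b => ?_
  exact ((tendsto_zeroCoupling hd hη t s).mul_const _).add
    ((Complex.continuous_re.tendsto _).comp (tendsto_tsum_southTerm hd hη ht hs a b))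

end

lemma isStokesSouthKernel_southKernel {d ξ η : ℝ} (hd : 0 < d) (hη : 0 < η) :
    IsStokesSouthKernel d ξ η (southKernel d ξ η) := by
  intro N s q hs hq
  -- The divergent constant c(β) is the source-only part of the zero mode.
  refine ⟨fun β => ∑ j, ((zeroFactor d η β * Real.exp ((s j).2 * β)) • zeroBlock).mulVec (q j),
    fun t ht => ?_⟩
  have hlim : Tendsto (fun β => velocity (reducedKernel d ξ η β) s q t) (𝓝[>] 0)
      (𝓝 (velocity (southKernel d ξ η) s q t)) := by
    refine tendsto_finsetSum _ fun j _ => ?_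
    have hc : Continuous fun M : Matrix (Fin 2) (Fin 2) ℝ => M.mulVec (q j) :=
      continuous_id.matrix_mulVec continuous_const
    exact (hc.tendsto _).comp (tendsto_reducedKernel hd hη ht (hs j))
  refine hlim.congr' ?_
  filter_upwards [self_mem_nhdsWithin] with β hβ
  -- The target-only part is one matrix common to all sources, applied to the total charge 0.
  have hz : ∑ j, ((zeroFactor d η β * (Real.exp (-t.2 * β) - 1)) • zeroBlock).mulVec (q j) = 0 := by
    rw [← Matrix.mulVec_sum, hq, Matrix.mulVec_zero]
  unfold velocity
  simp_rw [fun j => modifiedSouthKernel_eq_reducedKernel hd hη ht (hs j) hβ, Matrix.add_mulVec,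
    Finset.sum_add_distrib]
  rw [hz, zero_add, add_sub_cancel_left]

lemma zero_mem_unitCell (d ξ η : ℝ) : (0 : ℝ × ℝ) ∈ unitCell d ξ η :=
  ⟨0, by norm_num, 0, by norm_num, by simp; rfl⟩

/-- The difference c(β) - c'(β) does not involve the target, yet converges at each target to the
difference of the two velocities. That difference is therefore constant; it is evaluated at the
origin. -/
lemma IsStokesSouthKernel.velocity_eq {d ξ η : ℝ}
    {K K' : ℝ × ℝ → ℝ × ℝ → Matrix (Fin 2) (Fin 2) ℝ}
    (h : IsStokesSouthKernel d ξ η K) (h' : IsStokesSouthKernel d ξ η K') {N : ℕ}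
    (s : Fin N → ℝ × ℝ) (q : Fin N → Fin 2 → ℝ) (hs : ∀ j, s j ∈ unitCell d ξ η)
    (hq : ∑ j, q j = 0) :
    ∃ c : Fin 2 → ℝ, ∀ t ∈ unitCell d ξ η, velocity K' s q t = velocity K s q t + c := by
  obtain ⟨c, hc⟩ := h N s q hs hq
  obtain ⟨c', hc'⟩ := h' N s q hs hq
  have key : ∀ t ∈ unitCell d ξ η, Tendsto (fun β => c β - c' β) (𝓝[>] 0)
      (𝓝 (velocity K' s q t - velocity K s q t)) := fun t ht =>
    ((hc' t ht).sub (hc t ht)).congr fun β => by abel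
  refine ⟨velocity K' s q 0 - velocity K s q 0, fun t ht => ?_⟩
  rw [← tendsto_nhds_unique (key t ht) (key 0 (zero_mem_unitCell d ξ η))]
  abel

/-! ### Closed form of each mode and the low-rank factorization -/

/-- The `m`-th mode of the south kernel. -/
def southMode (d ξ η : ℝ) (t s : ℝ × ℝ) (m : ℤ) : Block :=
  if m = 0 then (-(1 / (2 * (d : ℂ) * (η : ℂ))) * ((t.2 : ℂ) * (s.2 : ℂ))) • !![1, 0; 0, 0]
  else (1 / (4 * (d : ℂ)) * (Complex.exp (-((|alpha d m| * (t.2 - s.2) : ℝ) : ℂ)) *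
      Complex.exp (Complex.I * ((alpha d m * (t.1 - s.1) : ℝ) : ℂ))) *
      (Complex.exp (-Qm d ξ η m) ^ 2 / (1 - Complex.exp (-Qm d ξ η m)))) •
    ((1 / ((|alpha d m| : ℝ) : ℂ)) • (1 : Block) -
      (((t.2 - s.2 : ℝ) : ℂ) +
        (2 - Complex.exp (-Qm d ξ η m)) / (1 - Complex.exp (-Qm d ξ η m)) * (η : ℂ)) • signBlock m)

section
variable {d ξ η : ℝ} {t s : ℝ × ℝ}

lemma norm_exp_neg_Qm (d ξ η : ℝ) (m : ℤ) :
    ‖Complex.exp (-Qm d ξ η m)‖ = Real.exp (-(|alpha d m| * η)) := by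
  rw [Complex.norm_exp]
  congr 1
  unfold Qm
  rw [Complex.neg_re, Complex.sub_re, Complex.ofReal_re, Complex.I_mul_re, Complex.ofReal_im,
    neg_zero, sub_zero]

lemma norm_exp_neg_Qm_lt_one (hd : 0 < d) (hη : 0 < η) {m : ℤ} (hm : m ≠ 0) :
    ‖Complex.exp (-Qm d ξ η m)‖ < 1 := by
  rw [norm_exp_neg_Qm, Real.exp_lt_one_iff]
  have := mul_pos (abs_pos.mpr (alpha_ne_zero hd hm)) hη
  linarith

/-- One row further south adds (ξ, η) to the offset and so multiplies the exponential by ω =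
exp(-Q_m). Row k carries ω^(k+2), and besides that k enters only linearly, through the vertical
offset. -/
lemma southTermLimit_eq {m : ℤ} (hm : m ≠ 0) (a b : Fin 2) (k : ℕ) :
    southTermLimit d ξ η t s a b (k, m) =
      1 / (4 * (d : ℂ)) * (Complex.exp (-((|alpha d m| * (t.2 - s.2) : ℝ) : ℂ)) *
        Complex.exp (Complex.I * ((alpha d m * (t.1 - s.1) : ℝ) : ℂ))) *
        Complex.exp (-Qm d ξ η m) ^ 2 * (Complex.exp (-Qm d ξ η m) ^ k *
        (1 / ((|alpha d m| : ℝ) : ℂ) * (1 : Block) a b -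
          (((t.2 - s.2 : ℝ) : ℂ) + (k + 2) * η) * signBlock m a b)) := by
  have e : ((Real.exp (-(|alpha d m| * rowZ η t s k)) : ℝ) : ℂ) *
      Complex.exp (Complex.I * ((alpha d m * rowX ξ t s k : ℝ) : ℂ)) =
      Complex.exp (-((|alpha d m| * (t.2 - s.2) : ℝ) : ℂ)) *
        Complex.exp (Complex.I * ((alpha d m * (t.1 - s.1) : ℝ) : ℂ)) *
        Complex.exp (-Qm d ξ η m) ^ 2 * Complex.exp (-Qm d ξ η m) ^ k := by
    rw [mul_assoc _ (Complex.exp (-Qm d ξ η m) ^ 2), ← pow_add, ← Complex.exp_nat_mul,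
      Complex.ofReal_exp, ← Complex.exp_add, ← Complex.exp_add, ← Complex.exp_add]
    congr 1
    unfold Qm rowZ rowX
    push_cast
    ring
  unfold southTermLimit
  rw [if_neg hm]
  simp only [limitMode, Matrix.smul_apply, Matrix.sub_apply, smul_eq_mul]
  have hz : ((rowZ η t s k : ℝ) : ℂ) = ((t.2 - s.2 : ℝ) : ℂ) + (k + 2) * η := by
    unfold rowZ; push_cast; ring
  rw [hz]
  linear_combination (1 / (4 * (d : ℂ)) * (1 / ((|alpha d m| : ℝ) : ℂ) * (1 : Block) a b -
    (((t.2 - s.2 : ℝ) : ℂ) + (k + 2) * η) * signBlock m a b)) * e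

/-- A geometric series plus one weighted by k. The coefficient of η comes from 2 + ω/(1 - ω) = (2 -
ω)/(1 - ω). -/
lemma hasSum_southTermLimit (hd : 0 < d) (hη : 0 < η) {m : ℤ} (hm : m ≠ 0) (a b : Fin 2) :
    HasSum (fun k : ℕ => southTermLimit d ξ η t s a b (k, m)) (southMode d ξ η t s m a b) := by
  have hlt := norm_exp_neg_Qm_lt_one (ξ := ξ) hd hη hm
  simp_rw [southTermLimit_eq hm]
  unfold southMode
  rw [if_neg hm]
  simp only [Matrix.smul_apply, Matrix.sub_apply, smul_eq_mul]
  set ω := Complex.exp (-Qm d ξ η m) with hω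
  have hne : 1 - ω ≠ 0 := by
    intro h0
    rw [← sub_eq_zero.mp h0] at hlt
    simp at hlt
  have h1 := (hasSum_geometric_of_norm_lt_one hlt).mul_left
    (1 / ((|alpha d m| : ℝ) : ℂ) * (1 : Block) a b -
      (((t.2 - s.2 : ℝ) : ℂ) + 2 * η) * signBlock m a b)
  have h2 := (hasSum_coe_mul_geometric_of_norm_lt_one hlt).mul_left (-(η * signBlock m a b))
  have h3 := (h1.add h2).mul_left (1 / (4 * (d : ℂ)) *
    (Complex.exp (-((|alpha d m| * (t.2 - s.2) : ℝ) : ℂ)) *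
        Complex.exp (Complex.I * ((alpha d m * (t.1 - s.1) : ℝ) : ℂ))) * ω ^ 2)
  refine Eq.subst (motive := fun v => HasSum _ v) ?_ (h3.congr_fun fun k => ?_)
  · field_simp
    ring
  · ring

/-- Joint summability permits summing over the rows before the modes. The product term -y y'/(2dη)
left by the zero mode takes the place m = 0. -/
lemma hasSum_southMode (hd : 0 < d) (hη : 0 < η) (ht : t ∈ unitCell d ξ η)
    (hs : s ∈ unitCell d ξ η) (a b : Fin 2) :
    HasSum (fun m : ℤ => southMode d ξ η t s m a b) ((southKernel d ξ η t s a b : ℝ) : ℂ) := by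
  have h1 := (Equiv.prodComm ℤ ℕ).hasSum_iff.mpr
    (summable_southTermLimit hd hη ht hs a b).hasSum
  have h2 := h1.prod_fiberwise (g := fun m => if m = 0 then 0 else southMode d ξ η t s m a b)
    (fun m => by
      by_cases hm : m = 0
      · simp [hm, southTermLimit, hasSum_zero]
      · simpa [hm] using hasSum_southTermLimit hd hη hm a b)
  have h3 := (hasSum_ite_eq (0 : ℤ) (southMode d ξ η t s 0 a b)).add h2
  rw [ofReal_southKernel hd hη ht hs]
  have e0 : ((-(t.2 * s.2 / (2 * d * η)) * zeroBlock a b : ℝ) : ℂ) =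
      southMode d ξ η t s 0 a b := by
    have : (d : ℂ) ≠ 0 := by exact_mod_cast hd.ne'
    have : (η : ℂ) ≠ 0 := by exact_mod_cast hη.ne'
    fin_cases a <;> fin_cases b <;> simp [southMode, zeroBlock]
    field_simp
  rw [e0]
  refine h3.congr_fun fun m => ?_
  by_cases hm : m = 0
  · simp [hm]
  · simp [hm]

end

lemma mul_diagonal_mul_apply {R l m n : Type*} [Semiring R] [Fintype m] [DecidableEq m]
    (A : Matrix l m R) (f : m → R) (B : Matrix m n R) (i : l) (j : n) :
    (A * Matrix.diagonal f * B) i j = ∑ k, A i k * f k * B k j := by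
  simp only [Matrix.mul_apply (M := A * Matrix.diagonal f), Matrix.mul_diagonal]

/-- The exponentials in y - y' and x - x' factor between L and R. The remaining factor y - y' is not
a product, and is supplied by the two terms containing D_T and D_S. -/
lemma southLowRank_apply (d ξ η ε : ℝ) {NT NS : ℕ} (t : Fin NT → ℝ × ℝ) (s : Fin NS → ℝ × ℝ)
    (l : Fin NT) (j : Fin NS) :
    southLowRank d ξ η ε t s l j =
      ∑ m ∈ Finset.Icc (-(truncation d η ε : ℤ)) (truncation d η ε : ℤ),
        southMode d ξ η (t l) (s j) m := by
  rw [← Finset.sum_coe_sort]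
  unfold southLowRank
  simp only [Matrix.add_apply, Matrix.sub_apply, diagY, Matrix.mul_diagonal, southDa, southDb,
    mul_diagonal_mul_apply, Matrix.diagonal_mul]
  rw [Finset.sum_mul, ← Finset.sum_sub_distrib, ← Finset.sum_add_distrib]
  refine Finset.sum_congr rfl fun m _ => ?_
  by_cases hm : (m : ℤ) = 0
  · simp only [southL, southR, southMode, hm, if_true, Matrix.of_apply, mul_zero, smul_zero,
      sub_zero, add_zero, smul_mul_assoc, mul_smul_comm, one_mul, mul_one]
    ext a b
    simp only [Matrix.smul_apply, smul_eq_mul]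
    ring
  · simp only [southL, southR, southMode, hm, if_false, Matrix.of_apply]
    have e1 : Complex.exp (-((|alpha d m| * ((t l).2 - (s j).2) : ℝ) : ℂ)) =
        Complex.exp (-((|alpha d m| * (t l).2 : ℝ) : ℂ)) *
          Complex.exp ((|alpha d m| * (s j).2 : ℝ) : ℂ) := by
      rw [← Complex.exp_add]; congr 1; push_cast; ring
    have e2 : Complex.exp (Complex.I * ((alpha d m * ((t l).1 - (s j).1) : ℝ) : ℂ)) =
        Complex.exp (Complex.I * ((alpha d m * (t l).1 : ℝ) : ℂ)) *
          Complex.exp (-(Complex.I * ((alpha d m * (s j).1 : ℝ) : ℂ))) := by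
      rw [← Complex.exp_add]; congr 1; push_cast; ring
    have e3 : Complex.exp (-2 * Qm d ξ η m) = Complex.exp (-Qm d ξ η m) ^ 2 := by
      rw [← Complex.exp_nat_mul]; congr 1; push_cast; ring
    rw [e1, e2, e3]
    simp only [smul_mul_assoc, mul_smul_comm, one_mul, mul_one]
    ext a b
    simp only [Matrix.smul_apply, Matrix.sub_apply, Matrix.add_apply, smul_eq_mul]
    push_cast
    ring

/-! ### Truncation error -/

lemma norm_one_block_apply_le (a b : Fin 2) : ‖(1 : Block) a b‖ ≤ 1 := by
  fin_cases a <;> fin_cases b <;> simp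

lemma norm_signBlock_apply_le {m : ℤ} (hm : m ≠ 0) (a b : Fin 2) : ‖signBlock m a b‖ ≤ 1 := by
  rcases Int.lt_or_gt_of_ne hm with h | h
  · fin_cases a <;> fin_cases b <;> simp [signBlock, Int.sign_eq_neg_one_of_neg h]
  · fin_cases a <;> fin_cases b <;> simp [signBlock, Int.sign_eq_one_of_pos h]

/-- The modes are at most `2 r^|m|`, `r = exp (-2πη/d)`, as soon as `r^|m| ≤ 1/4`. -/
lemma norm_southMode_le {d ξ η : ℝ} (hd : 0 < d) (hη : 0 < η) (hηd : η ≤ d) {t s : ℝ × ℝ}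
    (ht : t ∈ unitCell d ξ η) (hs : s ∈ unitCell d ξ η) {m : ℤ} (hm : m ≠ 0)
    (hr : Real.exp (-(|alpha d m| * η)) ≤ 1 / 4) (a b : Fin 2) :
    ‖southMode d ξ η t s m a b‖ ≤ 2 * Real.exp (-(|alpha d m| * η)) := by
  have hα := abs_pos.mpr (alpha_ne_zero hd hm)
  have hω := norm_exp_neg_Qm d ξ η m
  have hΔ : |t.2 - s.2| ≤ η := by
    have h1 := abs_snd_le_of_mem_unitCell hη ht
    have h2 := abs_snd_le_of_mem_unitCell hη hs
    exact (abs_sub _ _).trans (by linarith)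
  -- Of the two factors |ω| in |ω|², one absorbs exp(-|α|(y - y')), since |y - y'| ≤ η; the other
  -- provides the decay.
  have hE : Real.exp (-(|alpha d m| * (t.2 - s.2))) * Real.exp (-(|alpha d m| * η)) ≤ 1 := by
    rw [← Real.exp_add, Real.exp_le_one_iff]
    nlinarith [(abs_le.mp hΔ).1]
  have h1α : 1 / |alpha d m| ≤ d / 6 := by
    rw [abs_alpha hd, div_le_div_iff₀ (by positivity) (by positivity),
      show d * (2 * Real.pi / d * |(m : ℝ)|) = 2 * Real.pi * |(m : ℝ)| by field_simp]
    nlinarith [Real.pi_gt_three, one_le_abs_cast hm]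
  unfold southMode
  rw [if_neg hm]
  simp only [Matrix.smul_apply, Matrix.sub_apply, smul_eq_mul]
  set ω := Complex.exp (-Qm d ξ η m) with hωdef
  set R := Real.exp (-(|alpha d m| * η)) with hR
  have hR0 : 0 < R := Real.exp_pos _
  have h1ω : 3 / 4 ≤ ‖1 - ω‖ := by
    have := norm_sub_norm_le (1 : ℂ) ω
    rw [norm_one, hω] at this
    linarith
  have h2ω : ‖2 - ω‖ ≤ 9 / 4 := by
    refine (norm_sub_le _ _).trans ?_
    rw [hω, Complex.norm_ofNat]
    linarith
  have hq : ‖(2 - ω) / (1 - ω) * (η : ℂ)‖ ≤ 3 * η := by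
    rw [norm_mul, norm_div, Complex.norm_real, Real.norm_of_nonneg hη.le]
    gcongr
    rw [div_le_iff₀ (by linarith)]
    linarith
  -- Here η ≤ d enters: d/6 + 4η ≤ 5d, which cancels the prefactor 1/(4d) and makes the constant
  -- absolute.
  have hbr : ‖1 / ((|alpha d m| : ℝ) : ℂ) * (1 : Block) a b -
      (((t.2 - s.2 : ℝ) : ℂ) + (2 - ω) / (1 - ω) * (η : ℂ)) * signBlock m a b‖ ≤ 5 * d := by
    refine (norm_sub_le _ _).trans ?_
    rw [norm_mul, norm_mul, norm_div, norm_one, Complex.norm_real, Real.norm_of_nonneg hα.le]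
    have e1 : 1 / |alpha d m| * ‖(1 : Block) a b‖ ≤ d / 6 * 1 := by
      gcongr
      exact norm_one_block_apply_le a b
    have e2 : ‖((t.2 - s.2 : ℝ) : ℂ) + (2 - ω) / (1 - ω) * (η : ℂ)‖ ≤ 4 * η := by
      refine (norm_add_le _ _).trans ?_
      rw [Complex.norm_real, Real.norm_eq_abs]
      linarith
    have e3 : ‖((t.2 - s.2 : ℝ) : ℂ) + (2 - ω) / (1 - ω) * (η : ℂ)‖ * ‖signBlock m a b‖ ≤
        4 * η * 1 := by
      gcongr
      exact norm_signBlock_apply_le hm a b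
    linarith
  have hpre : ‖1 / (4 * (d : ℂ)) * (Complex.exp (-((|alpha d m| * (t.2 - s.2) : ℝ) : ℂ)) *
      Complex.exp (Complex.I * ((alpha d m * (t.1 - s.1) : ℝ) : ℂ))) * (ω ^ 2 / (1 - ω))‖ ≤
      1 / (4 * d) * (R * (4 / 3)) := by
    rw [norm_mul, norm_mul, norm_mul, norm_div, norm_div, norm_one, norm_mul, Complex.norm_real,
      Real.norm_of_nonneg hd.le, mul_comm Complex.I, Complex.norm_exp_ofReal_mul_I, mul_one,
      ← Complex.ofReal_neg, Complex.norm_exp_ofReal, norm_pow, hω, Complex.norm_ofNat,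
      mul_assoc (1 / (4 * d))]
    refine mul_le_mul_of_nonneg_left ?_ (by positivity)
    calc Real.exp (-(|alpha d m| * (t.2 - s.2))) * (R ^ 2 / ‖1 - ω‖)
        = (Real.exp (-(|alpha d m| * (t.2 - s.2))) * R) * R / ‖1 - ω‖ := by ring
      _ ≤ 1 * R / (3 / 4) := by gcongr
      _ = _ := by ring
  rw [norm_mul]
  calc _ ≤ 1 / (4 * d) * (R * (4 / 3)) * (5 * d) := by gcongr
    _ = 5 / 3 * R := by field_simp
    _ ≤ 2 * R := by linarith

/-- This is what M is chosen for: the factor 1 - r pays for the denominator of the geometric tail.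
-/
lemma exp_pow_truncation_le {d η ε : ℝ} (hd : 0 < d) (hη : 0 < η) (hε : 0 < ε) :
    Real.exp (-(2 * Real.pi * η / d)) ^ truncation d η ε ≤
      (1 - Real.exp (-(2 * Real.pi * η / d))) * ε := by
  set κ := 2 * Real.pi * η / d with hκ
  have hκ0 : 0 < κ := by positivity
  have hr : Real.exp (-κ) < 1 := by rw [Real.exp_lt_one_iff]; linarith
  have hpos : 0 < (1 - Real.exp (-κ)) * ε := mul_pos (by linarith) hε
  have hM : 1 / κ * Real.log (1 / (1 - Real.exp (-κ)) * (1 / ε)) ≤ truncation d η ε := by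
    have : d / (2 * Real.pi * η) = 1 / κ := by rw [hκ, one_div_div]
    rw [← this]
    exact Nat.le_ceil _
  rw [one_div_mul_one_div, one_div ((1 - _) * ε), Real.log_inv] at hM
  rw [← Real.exp_nat_mul]
  refine (Real.exp_le_exp.mpr ?_).trans_eq (Real.exp_log hpos)
  have := mul_le_mul_of_nonneg_left hM hκ0.le
  rw [← mul_assoc, mul_one_div_cancel hκ0.ne'] at this
  linarith

lemma hasSum_geometric_tail {r : ℝ} (hr0 : 0 ≤ r) (hr1 : r < 1) (M : ℕ) :
    HasSum (fun m : ℤ => if m ∈ Finset.Icc (-(M : ℤ)) (M : ℤ) then 0 else r ^ m.natAbs)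
      (2 * (r ^ (M + 1) * (1 - r)⁻¹)) := by
  set F : ℕ → ℝ := fun n => if n ≤ M then 0 else r ^ n with hF
  have h1 : HasSum F (r ^ (M + 1) * (1 - r)⁻¹) := by
    rw [← hasSum_nat_add_iff' (M + 1)]
    have h0 : ∑ i ∈ Finset.range (M + 1), F i = 0 :=
      Finset.sum_eq_zero fun i hi => if_pos (Nat.lt_succ_iff.mp (Finset.mem_range.mp hi))
    rw [h0, sub_zero]
    refine ((hasSum_geometric_of_lt_one hr0 hr1).mul_left (r ^ (M + 1))).congr_fun fun n => ?_
    rw [hF]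
    simp only
    rw [if_neg (by omega), ← pow_add, add_comm]
  -- The negative modes are indexed as m = -(n + 1). The shift leaves the sum unchanged because F 0
  -- = 0 even for M = 0.
  have h2 : HasSum (fun n => F (n + 1)) (r ^ (M + 1) * (1 - r)⁻¹) := by
    have := (hasSum_nat_add_iff' 1).mpr h1
    simpa [hF] using this
  rw [two_mul]
  refine HasSum.of_nat_of_neg_add_one (h1.congr_fun fun n => ?_) (h2.congr_fun fun n => ?_)
  · by_cases h : n ≤ M
    · rw [if_pos (Finset.mem_Icc.mpr (by omega)), hF]; simp [h]
    · rw [if_neg (by rw [Finset.mem_Icc]; omega), hF]; simp [h]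
  · by_cases h : n + 1 ≤ M
    · rw [if_pos (Finset.mem_Icc.mpr (by omega)), hF]; simp only; rw [if_pos h]
    · rw [if_neg (by rw [Finset.mem_Icc]; omega), hF]
      simp only
      rw [if_neg h]
      congr 1

/-- The error of the truncated low-rank operator. -/
lemma norm_southKernel_sub_southLowRank_le {d ξ η ε : ℝ} (hd : 0 < d) (hη : 0 < η) (hηd : η ≤ d)
    (hε : 0 < ε) (hε1 : ε ≤ 1) {NT NS : ℕ} {t : Fin NT → ℝ × ℝ} {s : Fin NS → ℝ × ℝ}
    (ht : ∀ l, t l ∈ unitCell d ξ η) (hs : ∀ j, s j ∈ unitCell d ξ η) (l : Fin NT) (j : Fin NS)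
    (a b : Fin 2) :
    ‖((southKernel d ξ η (t l) (s j) a b : ℝ) : ℂ) - southLowRank d ξ η ε t s l j a b‖ ≤ 4 * ε := by
  set M := truncation d η ε with hM
  set r := Real.exp (-(2 * Real.pi * η / d)) with hr
  have hκ : 0 < 2 * Real.pi * η / d := by positivity
  have hr0 : 0 < r := Real.exp_pos _
  have hr1 : r < 1 := by rw [hr, Real.exp_lt_one_iff]; linarith
  have hrM : r ^ M ≤ (1 - r) * ε := exp_pow_truncation_le hd hη hε
  have hR : ∀ m : ℤ, Real.exp (-(|alpha d m| * η)) = r ^ m.natAbs := by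
    intro m
    rw [hr, ← Real.exp_nat_mul, abs_alpha hd, Nat.cast_natAbs, Int.cast_abs]
    congr 1
    ring
  have h1 := hasSum_southMode hd hη (ht l) (hs j) a b
  have h2 : HasSum (fun m : ℤ => if m ∈ Finset.Icc (-(M : ℤ)) (M : ℤ) then
      southMode d ξ η (t l) (s j) m a b else 0) (southLowRank d ξ η ε t s l j a b) := by
    rw [southLowRank_apply, Matrix.sum_apply,
      ← Finset.sum_congr rfl fun m hm => if_pos (c := m ∈ Finset.Icc (-(M : ℤ)) (M : ℤ)) hm]
    exact hasSum_sum_of_ne_finset_zero fun m hm => if_neg hm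
  have h3 := h1.sub h2
  rw [← h3.tsum_eq]
  -- One factor 2 is the bound on a mode, the other counts both signs of m; together with r^(M+1)/(1
  -- - r) ≤ ε they give 4ε.
  refine (tsum_of_norm_bounded ((hasSum_geometric_tail hr0.le hr1 M).mul_left 2) fun m => ?_).trans ?_
  · by_cases hm : m ∈ Finset.Icc (-(M : ℤ)) (M : ℤ)
    · simp [hm]
    · simp only [if_neg hm, sub_zero]
      rw [Finset.mem_Icc] at hm
      have hm0 : m ≠ 0 := by rintro rfl; exact hm (by omega)
      rw [← hR]
      refine norm_southMode_le hd hη hηd (ht l) (hs j) hm0 ?_ a b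
      rw [hR]
      -- Outside the window the smallness 1/4 is automatic: r^(M+1) ≤ r(1 - r)ε and ε ≤ 1. This
      -- keeps 1 - ω away from 0 with no lower bound on η/d.
      calc r ^ m.natAbs ≤ r ^ (M + 1) := pow_le_pow_of_le_one hr0.le hr1.le (by omega)
        _ = r ^ M * r := pow_succ r M
        _ ≤ (1 - r) * ε * r := by gcongr
        _ ≤ (1 - r) * 1 * r := by
          have : 0 ≤ 1 - r := by linarith
          gcongr
        _ ≤ 1 / 4 := by nlinarith [sq_nonneg (2 * r - 1)]
  · have h1r : 0 < 1 - r := by linarith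
    have : r ^ (M + 1) * (1 - r)⁻¹ ≤ ε := by
      rw [mul_inv_le_iff₀ h1r, pow_succ]
      calc r ^ M * r ≤ r ^ M * 1 := by gcongr
        _ ≤ _ := by linarith
    linarith

end

end PeriodicStokes

theorem mainTheorem8 :
    ∃ C : ℝ, 0 < C ∧
      ∀ d ξ η : ℝ, 0 < d → 0 < η → Real.sqrt (ξ ^ 2 + η ^ 2) ≤ d →
        -- the image series of the modified Stokes south kernel converge
        (∀ β : ℝ, 0 < β → ∀ t ∈ unitCell d ξ η, ∀ s ∈ unitCell d ξ η,
          (∀ k : ℕ, Summable fun m : ℤ =>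
            modifiedStokeslet β (t - (s + latticeVec d ξ η m (-((k : ℤ) + 2))))) ∧
          Summable fun k : ℕ => modifiedSouthRow d ξ η β t s k) ∧
        ∃ K : ℝ × ℝ → ℝ × ℝ → Matrix (Fin 2) (Fin 2) ℝ,
          -- `K` is the south kernel for the Stokeslet with charge neutrality
          IsStokesSouthKernel d ξ η K ∧
          -- which is determined up to additive constants on charge neutral sources
          (∀ K' : ℝ × ℝ → ℝ × ℝ → Matrix (Fin 2) (Fin 2) ℝ, IsStokesSouthKernel d ξ η K' →
            ∀ (N : ℕ) (s : Fin N → ℝ × ℝ) (q : Fin N → Fin 2 → ℝ),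
              (∀ j, s j ∈ unitCell d ξ η) → ∑ j, q j = 0 →
              ∃ c : Fin 2 → ℝ, ∀ t ∈ unitCell d ξ η,
                velocity K' s q t = velocity K s q t + c) ∧
          -- the low-rank factorization
          ∀ (NT NS : ℕ) (t : Fin NT → ℝ × ℝ) (s : Fin NS → ℝ × ℝ),
            (∀ l, t l ∈ unitCell d ξ η) → (∀ j, s j ∈ unitCell d ξ η) →
            ∀ ε : ℝ, 0 < ε → ε ≤ 1 →
              ∀ (l : Fin NT) (j : Fin NS) (a b : Fin 2),
                ‖blockOperator K t s l j a b - southLowRank d ξ η ε t s l j a b‖ ≤ C * ε := by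
  refine ⟨4, by norm_num, fun d ξ η hd hη hde => ⟨fun β hβ t ht s hs =>
    ⟨fun k => summable_stokeslet_row hd hη ht hs hβ k, summable_southRow hd hη ht hs hβ⟩,
    southKernel d ξ η, isStokesSouthKernel_southKernel hd hη,
    fun K' hK' N s q hs hq =>
      (isStokesSouthKernel_southKernel hd hη).velocity_eq hK' s q hs hq,
    fun NT NS t s ht hs ε hε hε1 l j a b => ?_⟩⟩
  -- The length condition on (ξ, η) enters only through its vertical component.
  have hηd : η ≤ d := (Real.le_sqrt_of_sq_le (by nlinarith [sq_nonneg ξ])).trans hde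
  exact norm_southKernel_sub_southLowRank_le hd hη hηd hε hε1 ht hs l j a b
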